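/- **Setting.** Let $\mathcal X\subseteq\mathbb R^d$ and let $(\mathbf X_i,Z_i,A_i,Y_i)$, $i=1,\dots,n$, be i.i.d. with $\mathbf X_i\in\mathcal X$, binary instrument and treatment $Z_i,A_i\in\{-1,+1\}$ and outcome $Y_i\in\mathbb R$. Let $L\le U$ be measurable functions on $\mathcal X$ (the end points of the partial identification interval of the conditional average treatment effect), and put $\operatorname{sgn}(t)=1$ for $t>0$ and $-1$ otherwise, $\phi(t)=(1-t)^+$. For measurable $f:\mathcal X\to\mathbb R$ let $$\mathcal R_{\rm upper}(f)=\mathbb E\Big[\sup_{c\in[L(\mathbf X),U(\mathbf X)]}|c|\,\mathbb 1\{\operatorname{sgn}f(\mathbf X)\ne\operatorname{sgn}c\}\Big],\qquad \mathcal R^{*}_{\rm upper}=\inf_{f\text{ measurable}}\mathcal R_{\rm upper}(f),$$ and let $\mathcal R^{\rm h}_{\rm upper}(f)$ be the expectation of the surrogate loss equal to $|U|\phi(f)$ if $L>0$, to $|L|\phi(-f)$ if $U<0$, to $|L|+(|U|-|L|)\phi(f)$ if $L\le0\le U$ and $|U|\ge|L|$, and to $|U|+(|L|-|U|)\phi(-f)$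 if $L\le0\le U$ and $|U|<|L|$ (all evaluated at $\mathbf X$); $\mathcal R^{{\rm h},*}_{\rm upper}$ is its infimum over all measurable $f$. Let $\mathcal F$ be a class of measurable functions contained in a space of functions with norm $\|\cdot\|$, and let $\mathcal A(\mathcal F)=\inf_{f\in\mathcal F}\mathcal R^{\rm h}_{\rm upper}(f)-\mathcal R^{{\rm h},*}_{\rm upper}$ be its approximation error. **Estimator.** Let $I_1,I_2$ be a random partition of $\{1,\dots,n\}$, independent of the data, with $|I_1|$ and $|I_2|$ both of order $n$. Let $\widehat L,\widehat U$ be estimators of $L,U$ that use only the observations with indices in $I_1$, and put $$\widehat w=|\widehat U|\mathbb 1\{\widehat L>0\}+|\widehat L|\mathbb 1\{\widehat U<0\}+\big||\widehat U|-|\widehat L|\big|\mathbb 1\{\widehat L\le 0\le\widehat U\},$$ $$\widehat e=\mathbb 1\{\widehat U<0\}-\mathbb 1\{\widehat L>0\}-\operatorname{sgn}\{|\widehat U|-|\widehat L|\}\mathbb 1\{\widehat L\le0\le\widehat U\}.$$ For $\lambda_n>0$ with $\lambda_n\to0$, the sample-splitting IV-PILE estimator $\widehat f_n^{\lambda_n}$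 is a (measurably chosen) minimizer over $f\in\mathcal F$ of $$\frac1{|I_2|}\sum_{i\in I_2}\widehat w(\mathbf X_i)\{1+\widehat e(\mathbf X_i)f(\mathbf X_i)\}^++\frac{\lambda_n}2\|f\|^2 .$$ **Assumptions.** (1) $\mathcal R^{\rm h}_{\rm upper}$ attains its infimum over $\mathcal F$ at some element of $\mathcal F$. (2) For some constants $M_1>0$ and $M_2$, with probability $1$, $|L(\mathbf X)|,|U(\mathbf X)|,|Y|\le M_1$ and every coordinate of $\mathbf X$ is at most $M_2$ in absolute value. (3) For some constant $M_3$, not depending on $n$, $|\widehat L(\mathbf X)|,|\widehat U(\mathbf X)|\le M_3$ with probability $1$. (4) There are $\mathcal F_0\subseteq\mathcal F$, $C_0>0$ and $0<v<2$ such that $\mathcal F=\{af:f\in\mathcal F_0,a\in\mathbb R\}$; with probability $1$, $\widehat f_n^{\lambda_n}\in\{af:f\in\mathcal F_0,|a|\le C_0/\lambda_n\}$; and $\sup_Q\log N(\epsilon,\mathcal F_0,L_2(Q))\le K\epsilon^{-v}$ for all $0<\epsilon<1$ and some constant $K$, where $Q$ ranges over all probability measures on $\mathcal X$ and $N$ is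 the minimal number of closed $L_2(Q)$-balls of radius $\epsilon$ covering $\mathcal F_0$. (5) $\mathbb E|\widehat L(\mathbf X)-L(\mathbf X)|=O(n^{-\alpha})$ and $\mathbb E|\widehat U(\mathbf X)-U(\mathbf X)|=O(n^{-\beta})$, where $\mathbf X$ is independent of the data used for $\widehat L,\widehat U$. (6) There is $M_4>0$ with $\|f\|\ge M_4\|f\|_\infty$ for all $f\in\mathcal F$. **Claim.** Then the worst-case risk of $\widehat f_n^{\lambda_n}$, averaged over the sample and the partition, satisfies, as $n\to\infty$, $$\mathbb E\big[\mathcal R_{\rm upper}(\widehat f_n^{\lambda_n})\big]\le\mathcal R^{*}_{\rm upper}+\mathcal A(\mathcal F)+O\Big(\lambda_n+n^{-1/2}\lambda_n^{-1}+\lambda_n^{-1/2}\big(n^{-\alpha}+n^{-\beta}\big)\Big).$$ -/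

import Mathlib

open MeasureTheory Filter Topology
open scoped ENNReal

/-- The sign of a real number: `+1` for positive numbers and `-1` otherwise. -/
noncomputable def sgn (t : ℝ) : ℝ := if 0 < t then 1 else -1

/-- The hinge function `φ(t) = (1 - t)⁺`. -/
noncomputable def hinge (t : ℝ) : ℝ := max (1 - t) 0

/-- The worst-case weighted misclassification loss of the classifier value `t` when the contrast
is only known to lie in `[l, u]`: the supremum over `c ∈ [l, u]` of `|c| · 1{sgn t ≠ sgn c}`. -/
noncomputable def upperLoss (l u t : ℝ) : ℝ :=
  sSup ((fun c : ℝ => if sgn t ≠ sgn c then |c| else 0) '' Set.Icc l u)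

/-- The (lifted and scaled) hinge surrogate of `upperLoss`, one line for each configuration of
the interval `[l, u]`. -/
noncomputable def surrogateLoss (l u t : ℝ) : ℝ :=
  if 0 < l then |u| * hinge t
  else if u < 0 then |l| * hinge (-t)
  else if |l| ≤ |u| then |l| + (|u| - |l|) * hinge t
  else |u| + (|l| - |u|) * hinge (-t)

/-- The weight attached to an interval `[l, u]`. -/
noncomputable def weight (l u : ℝ) : ℝ :=
  |u| * (if 0 < l then 1 else 0) + |l| * (if u < 0 then 1 else 0)
    + |(|u| - |l|)| * (if l ≤ 0 ∧ 0 ≤ u then 1 else 0)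

/-- The label attached to an interval `[l, u]` (with the sign convention in which the loss of
`t` is `weight · (1 + label · t)⁺`). -/
noncomputable def label (l u : ℝ) : ℝ :=
  (if u < 0 then 1 else 0) - (if 0 < l then 1 else 0)
    - sgn (|u| - |l|) * (if l ≤ 0 ∧ 0 ≤ u then 1 else 0)

section Risk

variable {X : Type*} [MeasurableSpace X]

/-- The worst-case risk `R_upper(f)`; the loss is nonnegative, so that the expectation is taken
in `[0, ∞]`. -/
noncomputable def upperRisk (μ : Measure X) (L U f : X → ℝ) : ℝ≥0∞ :=
  ∫⁻ x, ENNReal.ofReal (upperLoss (L x) (U x) (f x)) ∂μ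

/-- The Bayes risk `R*_upper`: the infimum of the worst-case risk over all measurable functions. -/
noncomputable def bayesUpperRisk (μ : Measure X) (L U : X → ℝ) : ℝ≥0∞ :=
  ⨅ (f : X → ℝ) (_ : Measurable f), upperRisk μ L U f

/-- The surrogate risk `R^h_upper(f)`. -/
noncomputable def surrogateRisk (μ : Measure X) (L U f : X → ℝ) : ℝ≥0∞ :=
  ∫⁻ x, ENNReal.ofReal (surrogateLoss (L x) (U x) (f x)) ∂μ

/-- The surrogate Bayes risk `R^{h,*}_upper`: the infimum over all measurable functions. -/
noncomputable def bayesSurrogateRisk (μ : Measure X) (L U : X → ℝ) : ℝ≥0∞ :=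
  ⨅ (f : X → ℝ) (_ : Measurable f), surrogateRisk μ L U f

/-- The smallest surrogate risk in a class `F` of functions. -/
noncomputable def classSurrogateRisk (μ : Measure X) (L U : X → ℝ) (F : Set (X → ℝ)) : ℝ≥0∞ :=
  ⨅ f ∈ F, surrogateRisk μ L U f

/-- The approximation error `A(F)`. For a nonempty class of measurable functions the first term
is at least the second one, so the subtraction in `[0, ∞]` truncates nothing. -/
noncomputable def approxError (μ : Measure X) (L U : X → ℝ) (F : Set (X → ℝ)) : ℝ≥0∞ :=
  classSurrogateRisk μ L U F - bayesSurrogateRisk μ L U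

/-- The covering number `N(ε, G, L₂(Q))`: the smallest number of closed `L₂(Q)`-balls of
radius `ε` that cover `G`, and `⊤` if no finite number does. -/
noncomputable def coveringNumber (ε : ℝ) (G : Set (X → ℝ)) (Q : Measure X) : ℕ∞ :=
  ⨅ (T : Finset (X → ℝ)) (_ : (∀ t ∈ T, MemLp t 2 Q) ∧
    ∀ g ∈ G, ∃ t ∈ T, eLpNorm (fun x => g x - t x) 2 Q ≤ ENNReal.ofReal ε), (T.card : ℕ∞)

/-- `sup_Q log N(ε, G, L₂(Q)) ≤ K ε^{-v}` for all `0 < ε < 1`, the supremum being over all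
probability measures `Q`. -/
def UniformEntropyBound (G : Set (X → ℝ)) (K v : ℝ) : Prop :=
  ∀ ε : ℝ, 0 < ε → ε < 1 → ∀ Q : Measure X, IsProbabilityMeasure Q →
    coveringNumber ε G Q ≠ ⊤ ∧ Real.log ((coveringNumber ε G Q).toNat : ℝ) ≤ K * ε ^ (-v)

end Risk

/-- One observation `(X, Z, A, Y)`: covariates in `𝒳 ⊆ ℝ^d`, a binary instrument and a binary
treatment with values in `{-1, +1}`, and a real outcome. -/
abbrev Obs {d : ℕ} (𝒳 : Set (Fin d → ℝ)) : Type :=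
  𝒳 × ({-1, 1} : Set ℝ) × ({-1, 1} : Set ℝ) × ℝ

section Sample

variable {d : ℕ} {𝒳 : Set (Fin d → ℝ)}

/-- The law of the covariates. -/
noncomputable def covLaw (P : Measure (Obs 𝒳)) : Measure 𝒳 := P.map Prod.fst

/-- The expectation of a nonnegative function of the random index set `I₁` (with law `ρ`, and
`I₂` its complement) and of an independent i.i.d. sample of size `n` from `P`. -/
noncomputable def sampleExp (P : Measure (Obs 𝒳)) {n : ℕ} (ρ : PMF (Finset (Fin n)))
    (g : Finset (Fin n) → (Fin n → Obs 𝒳) → ℝ≥0∞) : ℝ≥0∞ :=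
  ∑ I₁ : Finset (Fin n), ρ I₁ * ∫⁻ D, g I₁ D ∂(Measure.pi fun _ : Fin n => P)

/-- A property of the random index set `I₁` and of the sample holds with probability one. -/
def SampleAE (P : Measure (Obs 𝒳)) {n : ℕ} (ρ : PMF (Finset (Fin n)))
    (p : Finset (Fin n) → (Fin n → Obs 𝒳) → Prop) : Prop :=
  ∀ I₁ ∈ ρ.support, ∀ᵐ D ∂(Measure.pi fun _ : Fin n => P), p I₁ D

/-- A rule which turns the observations with indices in `I₁` into a function of the covariates. -/
abbrev FirstHalfRule {d : ℕ} (𝒳 : Set (Fin d → ℝ)) : Type :=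
  (n : ℕ) → (I₁ : Finset (Fin n)) → (I₁ → Obs 𝒳) → 𝒳 → ℝ

/-- The function of the covariates that the rule `G` yields from the sample `D`: only the
observations with indices in `I₁` are used. -/
def fitted (G : FirstHalfRule 𝒳) {n : ℕ} (I₁ : Finset (Fin n)) (D : Fin n → Obs 𝒳) : 𝒳 → ℝ :=
  G n I₁ (fun i => D i)

/-- The penalized empirical surrogate risk on the second half `I₂ = I₁ᶜ` of the sample, with
penalty `pen` equal to the norm of `f`. -/
noncomputable def empObjective (Lhat Uhat : FirstHalfRule 𝒳) (lam : ℝ) {n : ℕ}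
    (I₁ : Finset (Fin n)) (D : Fin n → Obs 𝒳) (f : 𝒳 → ℝ) (pen : ℝ) : ℝ :=
  (1 / (I₁ᶜ.card : ℝ)) * ∑ i ∈ I₁ᶜ,
      weight (fitted Lhat I₁ D (D i).1) (fitted Uhat I₁ D (D i).1) *
        max (1 + label (fitted Lhat I₁ D (D i).1) (fitted Uhat I₁ D (D i).1) * f (D i).1) 0
    + lam / 2 * pen ^ 2

end Sample

/-! Put s = (-L)⁺ - U⁺ (`signedWeight`) and m = min((-L)⁺, U⁺) (`minLoss`). The worst-case loss is
(-L)⁺ where f > 0 and U⁺ elsewhere, while the four cases of the surrogate collapse to m + (|s| + s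
f)⁺. Hence the surrogate dominates the worst-case loss, and its pointwise minimum m, attained at f =
±1, lies below the worst-case loss of every f. The surrogate Bayes risk is therefore at most the
worst-case Bayes risk, and it suffices to bound the expected surrogate risk of the estimator by that
of the minimizer g over F plus the rate.

Fix a partition. Replacing the true end points by the fitted ones changes the loss at f by at most
2(1 + |f|) times the estimation error. Comparing the estimator with 0 in the penalized objective
bounds its sup norm by a multiple of λ^(-1/2), which yields the third term of the rate. Comparing it
with g leaves the penalty λ‖g‖²/2 and the deviation between population and empirical plug-in excess
losses. The fitted end points ignore the observations in I₂, so the plug-in loss is a fixed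
function, Lipschitz in f; symmetrization (`integral_deviation_le_of_swapPairs`) and contraction
(`exists_selection_contraction`) reduce the deviation to Rademacher averages of F₀ scaled by C₀/λ.
Chaining (`UniformEntropyBound.exists_radMean_le`) bounds these averages, since v < 2 makes the
entropy series geometric, and n^(-1/2) λ^(-1) results.

No supremum over F is ever formed, so none has to be measurable. The Rademacher lemmas speak of an
arbitrary selection of one function for each sign pattern; the selection that occurs is the
estimator refitted after exchanging observations with a ghost sample. -/

/-- The Rademacher sign attached to a Boolean. -/
def radSign (b : Bool) : ℝ := if b then 1 else -1

theorem radSign_not (b : Bool) : radSign (!b) = -radSign b := by cases b <;> simp [radSign]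

/-- The average of a function of the signs over all sign patterns. -/
noncomputable def radMean {ι : Type*} [Fintype ι] [DecidableEq ι] (g : (ι → Bool) → ℝ) : ℝ :=
  (∑ σ : ι → Bool, g σ) / 2 ^ Fintype.card ι

/-! ### Rademacher averages: finite maximal inequality and contraction -/

section Rademacher

variable {ι : Type*} [Fintype ι] [DecidableEq ι]

theorem radMean_mono {g h : (ι → Bool) → ℝ} (H : ∀ σ, g σ ≤ h σ) : radMean g ≤ radMean h := by
  unfold radMean
  gcongr with σ
  exact H σ

theorem radMean_add (g h : (ι → Bool) → ℝ) :
    radMean (fun σ => g σ + h σ) = radMean g + radMean h := by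
  simp [radMean, Finset.sum_add_distrib, add_div]

theorem radMean_const_mul (c : ℝ) (g : (ι → Bool) → ℝ) :
    radMean (fun σ => c * g σ) = c * radMean g := by
  simp [radMean, ← Finset.mul_sum, mul_div_assoc]

theorem radMean_const (c : ℝ) : radMean (fun _ : ι → Bool => c) = c := by
  simp [radMean]

/-- The signs are independent under the uniform average, so the exponential factorizes; indices
outside `I` contribute cosh 0 = 1. -/
theorem radMean_exp_sum (I : Finset ι) (x : ι → ℝ) :
    radMean (fun σ => Real.exp (∑ i ∈ I, radSign (σ i) * x i)) = ∏ i ∈ I, Real.cosh (x i) := by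
  classical
  have h1 : ∀ σ : ι → Bool, Real.exp (∑ i ∈ I, radSign (σ i) * x i)
      = ∏ i, Real.exp (radSign (σ i) * (if i ∈ I then x i else 0)) := by
    intro σ
    rw [← Real.exp_sum]
    simp [Finset.sum_ite_mem]
  have h2 : ∏ i ∈ I, Real.cosh (x i) = ∏ i, Real.cosh (if i ∈ I then x i else 0) := by
    rw [← Finset.prod_subset (Finset.subset_univ I)]
    · exact Finset.prod_congr rfl fun i hi => by simp [hi]
    · intro i _ hi
      simp [hi]
  unfold radMean
  simp_rw [h1]
  rw [h2, ← Finset.card_univ, ← Finset.prod_const, ← Fintype.piFinset_univ,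
    ← Finset.prod_univ_sum (fun _ => Finset.univ)
      (fun i b => Real.exp (radSign b * (if i ∈ I then x i else 0))),
    ← Finset.prod_div_distrib]
  refine Finset.prod_congr rfl fun i _ => ?_
  split_ifs <;> simp [radSign, Real.cosh_eq]

theorem radMean_exp_sum_le (I : Finset ι) (x : ι → ℝ) :
    radMean (fun σ => Real.exp (∑ i ∈ I, radSign (σ i) * x i))
      ≤ Real.exp ((∑ i ∈ I, x i ^ 2) / 2) := by
  rw [radMean_exp_sum, Finset.sum_div, Real.exp_sum]
  exact Finset.prod_le_prod (fun i _ => (Real.cosh_pos _).le)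
    fun i _ => Real.cosh_le_exp_half_sq _

/-- The maximal inequality for Rademacher sums over a finite set of vectors of norm at most `r`,
for a selection of one vector for each sign pattern. -/
theorem radMean_abs_le_of_finite {κ : Type*} (I : Finset ι) (T : Finset κ) (x : κ → ι → ℝ)
    {r : ℝ} (hr : 0 < r) (hx : ∀ k ∈ T, ∑ i ∈ I, x k i ^ 2 ≤ r ^ 2)
    (τ : (ι → Bool) → κ) (hτ : ∀ σ, τ σ ∈ T) :
    radMean (fun σ => |∑ i ∈ I, radSign (σ i) * x (τ σ) i|)
      ≤ r * √(2 * Real.log (2 * T.card)) := by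
  have hT : 1 ≤ (T.card : ℝ) := by
    exact_mod_cast Finset.card_pos.2 ⟨_, hτ fun _ => true⟩
  -- The factor 2 pays for the absolute value, through exp(s|y|) ≤ exp(sy) + exp(-sy).
  set N : ℝ := 2 * T.card with hN
  have hN1 : 1 < N := by linarith
  have hlog : 0 < Real.log N := Real.log_pos hN1
  set q := √(2 * Real.log N) with hq
  have hq0 : 0 < q := Real.sqrt_pos.2 (by positivity)
  have hq2 : q ^ 2 = 2 * Real.log N := Real.sq_sqrt (by positivity)
  -- This parameter minimizes (log N)/s + s r²/2, with minimum r √(2 log N).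
  set s := q / r with hs
  have hs0 : 0 < s := by positivity
  set M := N * Real.exp (s ^ 2 * r ^ 2 / 2) with hM
  have hM0 : 0 < M := by positivity
  have hexp : ∀ c : ℝ, c ^ 2 = s ^ 2 → ∀ k ∈ T,
      radMean (fun σ => Real.exp (∑ i ∈ I, radSign (σ i) * (c * x k i)))
        ≤ Real.exp (s ^ 2 * r ^ 2 / 2) := by
    intro c hc k hk
    refine (radMean_exp_sum_le I _).trans ?_
    simp_rw [mul_pow, ← Finset.mul_sum, hc]
    gcongr
    exact hx k hk
  have hfac : ∀ (c : ℝ) (σ : ι → Bool) (k : κ),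
      ∑ i ∈ I, radSign (σ i) * (c * x k i) = c * ∑ i ∈ I, radSign (σ i) * x k i := by
    intro c σ k
    rw [Finset.mul_sum]
    exact Finset.sum_congr rfl fun i _ => by ring
  have hsum : radMean (fun σ => Real.exp (s * |∑ i ∈ I, radSign (σ i) * x (τ σ) i|)) ≤ M := by
    calc radMean (fun σ => Real.exp (s * |∑ i ∈ I, radSign (σ i) * x (τ σ) i|))
        ≤ radMean (fun σ => ∑ k ∈ T, (Real.exp (∑ i ∈ I, radSign (σ i) * (s * x k i))
            + Real.exp (∑ i ∈ I, radSign (σ i) * (-s * x k i)))) := by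
          refine radMean_mono fun σ => ?_
          refine le_trans ?_ (Finset.single_le_sum (f := fun k =>
            (Real.exp (∑ i ∈ I, radSign (σ i) * (s * x k i))
            + Real.exp (∑ i ∈ I, radSign (σ i) * (-s * x k i))))
            (fun k _ => by positivity) (hτ σ))
          simp only [hfac]
          rcases abs_cases (∑ i ∈ I, radSign (σ i) * x (τ σ) i) with ⟨h, _⟩ | ⟨h, _⟩ <;> rw [h]
          · exact le_add_of_nonneg_right (Real.exp_pos _).le
          · rw [mul_neg, ← neg_mul]
            exact le_add_of_nonneg_left (Real.exp_pos _).le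
      _ = ∑ k ∈ T, (radMean (fun σ => Real.exp (∑ i ∈ I, radSign (σ i) * (s * x k i)))
            + radMean (fun σ => Real.exp (∑ i ∈ I, radSign (σ i) * (-s * x k i)))) := by
          simp_rw [← radMean_add]
          unfold radMean
          rw [Finset.sum_comm, Finset.sum_div]
      _ ≤ ∑ k ∈ T, (Real.exp (s ^ 2 * r ^ 2 / 2) + Real.exp (s ^ 2 * r ^ 2 / 2)) := by
          refine Finset.sum_le_sum fun k hk => add_le_add (hexp s rfl k hk) (hexp (-s) ?_ k hk)
          ring
      _ = M := by
          rw [Finset.sum_const, nsmul_eq_mul, hM, hN]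
          ring
  -- The tangent line of log at M, evaluated at exp(sy), takes the place of Jensen's inequality.
  have hpt : ∀ y : ℝ, y ≤ s⁻¹ * (Real.log M - 1) + s⁻¹ * M⁻¹ * Real.exp (s * y) := by
    intro y
    have h := Real.add_one_le_exp (s * y - Real.log M)
    rw [Real.exp_sub, Real.exp_log hM0] at h
    have h' := mul_le_mul_of_nonneg_left h (inv_nonneg.2 hs0.le)
    have e : s⁻¹ * (s * y - Real.log M + 1) = y - s⁻¹ * (Real.log M - 1) := by
      field_simp
      ring
    rw [e] at h'
    have e2 : s⁻¹ * (Real.exp (s * y) / M) = s⁻¹ * M⁻¹ * Real.exp (s * y) := by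
      field_simp
    linarith
  calc radMean (fun σ => |∑ i ∈ I, radSign (σ i) * x (τ σ) i|)
      ≤ radMean (fun σ => s⁻¹ * (Real.log M - 1) + s⁻¹ * M⁻¹ *
          Real.exp (s * |∑ i ∈ I, radSign (σ i) * x (τ σ) i|)) := radMean_mono fun σ => hpt _
    _ = s⁻¹ * (Real.log M - 1) + s⁻¹ * M⁻¹ *
          radMean (fun σ => Real.exp (s * |∑ i ∈ I, radSign (σ i) * x (τ σ) i|)) := by
        rw [radMean_add, radMean_const_mul (s⁻¹ * M⁻¹), radMean_const]
    _ ≤ s⁻¹ * (Real.log M - 1) + s⁻¹ * M⁻¹ * M := by gcongr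
    _ = s⁻¹ * Real.log M := by field_simp; ring
    _ = r * q := by
        rw [hM, Real.log_mul (by positivity) (by positivity), Real.log_exp, hs]
        field_simp
        linarith

/-- One coordinate of the contraction principle. -/
theorem exists_selection_contract {κ : Type*} (j : ι) (x : κ → ι → ℝ) (u : κ → (ι → Bool) → ℝ)
    (hu : ∀ k σ b, u k (Function.update σ j b) = u k σ) (φ : ℝ → ℝ) {W : ℝ}
    (hφ : ∀ s t, |φ s - φ t| ≤ W * |s - t|) (τ : (ι → Bool) → κ) :
    ∃ τ' : (ι → Bool) → κ, Set.range τ' ⊆ Set.range τ ∧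
      radMean (fun σ => u (τ σ) σ + radSign (σ j) * φ (x (τ σ) j))
        ≤ radMean (fun σ => u (τ' σ) σ + radSign (σ j) * (W * x (τ' σ) j)) := by
  classical
  let flip : (ι → Bool) → (ι → Bool) := fun σ => Function.update σ j (!σ j)
  have hinv : Function.Involutive flip := fun σ => by simp [flip]
  let c : (ι → Bool) → Prop := fun σ =>
    x (τ (Function.update σ j false)) j ≤ x (τ (Function.update σ j true)) j
  have hc : ∀ σ, c (flip σ) ↔ c σ := fun σ => by simp [c, flip]
  -- A pattern and its flip contribute together φ(a) - φ(b) ≤ W|a - b|, with a and b the coordinates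
  -- selected at sign + and at sign -. If b ≤ a the selection is kept; otherwise the two selections
  -- are exchanged, which does not alter the `u` terms because `u` ignores the sign `j`.
  let τ' : (ι → Bool) → κ := fun σ => if c σ then τ σ else τ (flip σ)
  refine ⟨τ', ?_, ?_⟩
  · rintro _ ⟨σ, rfl⟩
    by_cases h : c σ <;> simp [τ', h]
  have hsym : ∀ g : (ι → Bool) → ℝ, 2 * radMean g = radMean (fun σ => g σ + g (flip σ)) := by
    intro g
    rw [radMean_add, two_mul]
    congr 1
    unfold radMean
    congr 1
    exact (Equiv.sum_comp hinv.toPerm g).symm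
  have key : 2 * radMean (fun σ => u (τ σ) σ + radSign (σ j) * φ (x (τ σ) j))
      ≤ 2 * radMean (fun σ => u (τ' σ) σ + radSign (σ j) * (W * x (τ' σ) j)) := by
    rw [hsym, hsym]
    refine radMean_mono fun σ => ?_
    have e1 : ∀ k, u k (flip σ) = u k σ := fun k => hu k σ _
    have e2 : radSign (flip σ j) = -radSign (σ j) := by simp [flip, radSign_not]
    have e3 : flip (flip σ) = σ := hinv σ
    have hlip := hφ (x (τ σ) j) (x (τ (flip σ)) j)
    have hlip1 := (abs_le.1 hlip).1
    have hlip2 := (abs_le.1 hlip).2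
    have hup : ∀ b, σ j = b → Function.update σ j b = σ := by
      rintro b rfl
      simp
    by_cases h : c σ
    · simp only [τ', (hc σ).2 h, h, if_true, e1, e2]
      cases hb : σ j
      · have h' : x (τ σ) j ≤ x (τ (flip σ)) j := by
          have := h
          simp only [c, hup _ hb] at this
          simpa [flip, hb] using this
        rw [abs_of_nonpos (by linarith)] at hlip1 hlip2
        simp only [radSign]
        norm_num
        linarith
      · have h' : x (τ (flip σ)) j ≤ x (τ σ) j := by
          have := h
          simp only [c, hup _ hb] at this
          simpa [flip, hb] using this
        rw [abs_of_nonneg (by linarith)] at hlip1 hlip2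
        simp only [radSign]
        norm_num
        linarith
    · simp only [τ', (hc σ).not.2 h, h, if_false, e1, e2, e3]
      cases hb : σ j
      · have h' : x (τ (flip σ)) j < x (τ σ) j := by
          have := h
          simp only [c, hup _ hb] at this
          simpa [flip, hb] using this
        rw [abs_of_nonneg (by linarith)] at hlip1 hlip2
        simp only [radSign]
        norm_num
        linarith
      · have h' : x (τ σ) j < x (τ (flip σ)) j := by
          have := h
          simp only [c, hup _ hb] at this
          simpa [flip, hb] using this
        rw [abs_of_nonpos (by linarith)] at hlip1 hlip2
        simp only [radSign]
        norm_num
        linarith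
  linarith

/-- The contraction principle for Rademacher averages, in terms of selections of one vector for
each sign pattern. -/
theorem exists_selection_contraction {κ : Type*} (I : Finset ι) (x : κ → ι → ℝ)
    (φ : ι → ℝ → ℝ) {W : ℝ} (hφ : ∀ i ∈ I, ∀ s t, |φ i s - φ i t| ≤ W * |s - t|)
    (τ : (ι → Bool) → κ) :
    ∃ τ' : (ι → Bool) → κ, Set.range τ' ⊆ Set.range τ ∧
      radMean (fun σ => ∑ i ∈ I, radSign (σ i) * φ i (x (τ σ) i))
        ≤ W * radMean (fun σ => ∑ i ∈ I, radSign (σ i) * x (τ' σ) i) := by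
  classical
  -- The coordinates in `S` are already linearized; induction on `S` treats one coordinate at a
  -- time.
  suffices H : ∀ S ⊆ I, ∃ τ' : (ι → Bool) → κ, Set.range τ' ⊆ Set.range τ ∧
      radMean (fun σ => ∑ i ∈ I, radSign (σ i) * φ i (x (τ σ) i))
        ≤ radMean (fun σ => ∑ i ∈ S, radSign (σ i) * (W * x (τ' σ) i)
          + ∑ i ∈ I \ S, radSign (σ i) * φ i (x (τ' σ) i)) by
    obtain ⟨τ', h1, h2⟩ := H I subset_rfl
    refine ⟨τ', h1, h2.trans_eq ?_⟩
    rw [← radMean_const_mul]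
    congr 1
    ext σ
    simp only [sdiff_self, Finset.bot_eq_empty, Finset.sum_empty, add_zero, Finset.mul_sum]
    exact Finset.sum_congr rfl fun i _ => by ring
  intro S
  induction S using Finset.induction_on with
  | empty => exact fun _ => ⟨τ, subset_rfl, by simp⟩
  | insert j S hj ih =>
    intro hS
    have hjI : j ∈ I := hS (Finset.mem_insert_self j S)
    obtain ⟨τ₁, h1, h2⟩ := ih ((Finset.subset_insert j S).trans hS)
    let u : κ → (ι → Bool) → ℝ := fun k σ => ∑ i ∈ S, radSign (σ i) * (W * x k i)
      + ∑ i ∈ I \ insert j S, radSign (σ i) * φ i (x k i)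
    have hu : ∀ k σ b, u k (Function.update σ j b) = u k σ := by
      intro k σ b
      simp only [u]
      congr 1
      · refine Finset.sum_congr rfl fun i hi => ?_
        rw [Function.update_of_ne (by rintro rfl; exact hj hi)]
      · refine Finset.sum_congr rfl fun i hi => ?_
        rw [Function.update_of_ne (by rintro rfl; simp at hi)]
    obtain ⟨τ₂, h3, h4⟩ := exists_selection_contract j x u hu (φ j) (hφ j hjI) τ₁
    refine ⟨τ₂, h3.trans h1, h2.trans (le_trans (le_of_eq ?_) (h4.trans (le_of_eq ?_)))⟩
    · congr 1
      ext σ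
      have : I \ S = insert j (I \ insert j S) := by
        ext i
        simp only [Finset.mem_sdiff, Finset.mem_insert]
        by_cases hij : i = j
        · subst hij; simp [hjI, hj]
        · simp [hij]
      rw [this, Finset.sum_insert (by simp)]
      simp only [u]
      ring
    · congr 1
      ext σ
      rw [Finset.sum_insert hj]
      simp only [u]
      ring

end Rademacher

/-! ### Uniform entropy: optimal covers, boundedness, empirical covers -/

section Entropy

variable {X : Type*} [MeasurableSpace X]

/-- A nonempty infimum in `ℕ∞` is attained, and a finite covering number rules out an empty family
of covers. -/
theorem UniformEntropyBound.exists_cover {G : Set (X → ℝ)} {K v : ℝ}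
    (h : UniformEntropyBound G K v) {ε : ℝ} (hε : 0 < ε) (hε1 : ε < 1) (Q : Measure X)
    (hQ : IsProbabilityMeasure Q) :
    ∃ T : Finset (X → ℝ), (∀ t ∈ T, MemLp t 2 Q) ∧
      (∀ g ∈ G, ∃ t ∈ T, eLpNorm (fun x => g x - t x) 2 Q ≤ ENNReal.ofReal ε) ∧
      Real.log T.card ≤ K * ε ^ (-v) := by
  obtain ⟨h1, h2⟩ := h ε hε hε1 Q hQ
  have hne : Nonempty {T : Finset (X → ℝ) // (∀ t ∈ T, MemLp t 2 Q) ∧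
      ∀ g ∈ G, ∃ t ∈ T, eLpNorm (fun x => g x - t x) 2 Q ≤ ENNReal.ofReal ε} := by
    by_contra hcon
    apply h1
    unfold coveringNumber
    simp only [iInf_eq_top]
    exact fun T hT => (hcon ⟨⟨T, hT⟩⟩).elim
  have heq : coveringNumber ε G Q = ⨅ T : {T : Finset (X → ℝ) // (∀ t ∈ T, MemLp t 2 Q) ∧
      ∀ g ∈ G, ∃ t ∈ T, eLpNorm (fun x => g x - t x) 2 Q ≤ ENNReal.ofReal ε},
        (T.1.card : ℕ∞) := by
    rw [iInf_subtype]
    rfl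
  obtain ⟨⟨T, hT⟩, hTc⟩ := ciInf_mem (fun T : {T : Finset (X → ℝ) // (∀ t ∈ T, MemLp t 2 Q) ∧
      ∀ g ∈ G, ∃ t ∈ T, eLpNorm (fun x => g x - t x) 2 Q ≤ ENNReal.ofReal ε} =>
        (T.1.card : ℕ∞))
  rw [← heq] at hTc
  refine ⟨T, hT.1, hT.2, ?_⟩
  rw [← hTc] at h2
  simpa using h2

variable [MeasurableSingletonClass X]

/-- A class with a uniform entropy bound is uniformly bounded. -/
theorem UniformEntropyBound.exists_bound {G : Set (X → ℝ)} {K v : ℝ}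
    (h : UniformEntropyBound G K v) : ∃ B : ℝ, 0 < B ∧ ∀ g ∈ G, ∀ x, |g x| ≤ B := by
  by_contra! hcon
  have hex : ∀ k : ℕ, ∃ g ∈ G, ∃ x, (k + 1 : ℝ) * 2 ^ (k + 1) < |g x| := fun k =>
    hcon _ (by positivity)
  choose g hg x hx using hex
  -- Masses 2^(-(k+1)) sum to 1. The atom at `x k` forces the L₂(Q) norm of `g k` above k + 1,
  -- whereas a finite cover by L₂ functions bounds the L₂(Q) norm on all of `G`.
  let c : ℕ → ℝ≥0∞ := fun k => ENNReal.ofReal (1 / 2 / 2 ^ k)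
  let Q : Measure X := Measure.sum fun k => c k • Measure.dirac (x k)
  have hQ : IsProbabilityMeasure Q := by
    constructor
    simp only [Q, Measure.sum_apply _ MeasurableSet.univ, Measure.smul_apply, measure_univ,
      smul_eq_mul, mul_one, c]
    rw [← ENNReal.ofReal_tsum_of_nonneg (fun n => by positivity) (summable_geometric_two' 1),
      tsum_geometric_two']
    simp
  obtain ⟨T, hT, hcov, -⟩ := h.exists_cover (ε := 1 / 2) (by norm_num) (by norm_num) Q hQ
  have hatom : ∀ (f : X → ℝ) (k : ℕ), c k * ‖f (x k)‖ₑ ≤ eLpNorm f 2 Q := by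
    intro f k
    have hc1 : c k ≤ 1 := by
      simp only [c]
      rw [ENNReal.ofReal_le_one, div_le_one (by positivity)]
      have : (1 : ℝ) ≤ 2 ^ k := one_le_pow₀ (by norm_num)
      linarith
    calc c k * ‖f (x k)‖ₑ ≤ c k ^ (1 / (2 : ℝ≥0∞)).toReal * ‖f (x k)‖ₑ := by
          -- The atom contributes the square root of its mass; as the mass is at most 1, the mass
          -- itself is a cruder lower factor.
          gcongr
          conv_lhs => rw [← ENNReal.rpow_one (c k)]
          apply ENNReal.rpow_le_rpow_of_exponent_ge hc1
          norm_num
      _ = eLpNorm f 2 (c k • Measure.dirac (x k)) := by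
          rw [eLpNorm_smul_measure_of_ne_top (by norm_num), eLpNorm_dirac _ _ (by norm_num),
            smul_eq_mul]
      _ ≤ eLpNorm f 2 Q :=
          eLpNorm_mono_measure f (Measure.le_sum (fun k => c k • Measure.dirac (x k)) k)
  let R : ℝ≥0∞ := ENNReal.ofReal (1 / 2) + ∑ t ∈ T, eLpNorm t 2 Q
  have hR : R ≠ ⊤ := ENNReal.add_ne_top.2
    ⟨ENNReal.ofReal_ne_top, ENNReal.sum_ne_top.2 fun t ht => (hT t ht).2.ne⟩
  have hle : ∀ k : ℕ, (k : ℝ≥0∞) ≤ R := by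
    intro k
    obtain ⟨t, ht, hgt⟩ := hcov (g k) (hg k)
    calc (k : ℝ≥0∞) ≤ c k * ‖g k (x k)‖ₑ := by
          rw [Real.enorm_eq_ofReal_abs, ← ENNReal.ofReal_natCast,
            ← ENNReal.ofReal_mul (by positivity)]
          refine ENNReal.ofReal_le_ofReal ?_
          have h1 := (hx k).le
          calc (k : ℝ) ≤ 1 / 2 / 2 ^ k * ((k + 1 : ℝ) * 2 ^ (k + 1)) := by
                rw [pow_succ]
                field_simp
                linarith
            _ ≤ _ := by gcongr
      _ ≤ c k * (‖g k (x k) - t (x k)‖ₑ + ‖t (x k)‖ₑ) := by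
          gcongr
          calc ‖g k (x k)‖ₑ = ‖(g k (x k) - t (x k)) + t (x k)‖ₑ := by rw [sub_add_cancel]
            _ ≤ _ := enorm_add_le _ _
      _ = c k * ‖(fun y => g k y - t y) (x k)‖ₑ + c k * ‖t (x k)‖ₑ := mul_add _ _ _
      _ ≤ ENNReal.ofReal (1 / 2) + eLpNorm t 2 Q :=
          add_le_add ((hatom _ k).trans hgt) (hatom t k)
      _ ≤ R := by
          refine add_le_add le_rfl (Finset.single_le_sum (f := fun t => eLpNorm t 2 Q) ?_ ht)
          exact fun _ _ => bot_le
  obtain ⟨k, hk⟩ := ENNReal.exists_nat_gt hR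
  exact absurd (hle k) (not_le.2 hk)

theorem eLpNorm_two_empirical_le_iff {ι : Type*} (I : Finset ι) (hI : I.Nonempty) (z : ι → X)
    (f : X → ℝ) {ε : ℝ} (hε : 0 ≤ ε) :
    eLpNorm f 2 ((I.card : ℝ≥0∞)⁻¹ • ∑ i ∈ I, Measure.dirac (z i)) ≤ ENNReal.ofReal ε ↔
      ∑ i ∈ I, f (z i) ^ 2 ≤ I.card * ε ^ 2 := by
  have hm : (0 : ℝ) < I.card := by exact_mod_cast hI.card_pos
  rw [eLpNorm_eq_lintegral_rpow_enorm_toReal (by norm_num) (by norm_num),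
    lintegral_smul_measure, lintegral_finsetSum_measure]
  simp only [lintegral_dirac, ENNReal.toReal_ofNat, smul_eq_mul, one_div]
  have h1 : ∀ i, ‖f (z i)‖ₑ ^ (2 : ℝ) = ENNReal.ofReal (f (z i) ^ 2) := by
    intro i
    rw [Real.enorm_eq_ofReal_abs, ENNReal.ofReal_rpow_of_nonneg (abs_nonneg _) (by norm_num)]
    simp
  have h2 : (I.card : ℝ≥0∞)⁻¹ * ∑ i ∈ I, ‖f (z i)‖ₑ ^ (2 : ℝ)
      = ENNReal.ofReal ((I.card : ℝ)⁻¹ * ∑ i ∈ I, f (z i) ^ 2) := by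
    simp_rw [h1]
    rw [← ENNReal.ofReal_sum_of_nonneg (fun i _ => by positivity),
      ENNReal.ofReal_mul (by positivity), ENNReal.ofReal_inv_of_pos hm, ENNReal.ofReal_natCast]
  rw [h2, ENNReal.rpow_inv_le_iff (by norm_num),
    ENNReal.ofReal_rpow_of_nonneg hε (by norm_num), ENNReal.ofReal_le_ofReal_iff (by positivity),
    inv_mul_le_iff₀ hm]
  norm_num

/-- Taking Q to be the empirical measure of the points `z` gives a bound free of `z`: uniformity in
Q is used here. The map `p` projects the class onto the net. -/
theorem UniformEntropyBound.exists_empirical_cover {G : Set (X → ℝ)} {K v : ℝ}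
    (h : UniformEntropyBound G K v) {ε : ℝ} (hε : 0 < ε) (hε1 : ε < 1) {ι : Type*}
    (I : Finset ι) (hI : I.Nonempty) (z : ι → X) :
    ∃ (T : Finset (X → ℝ)) (p : (X → ℝ) → (X → ℝ)), (∀ g ∈ G, p g ∈ T) ∧
      (∀ g ∈ G, ∑ i ∈ I, (g (z i) - p g (z i)) ^ 2 ≤ I.card * ε ^ 2) ∧
      Real.log T.card ≤ K * ε ^ (-v) := by
  classical
  let Q : Measure X := (I.card : ℝ≥0∞)⁻¹ • ∑ i ∈ I, Measure.dirac (z i)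
  have hQ : IsProbabilityMeasure Q := by
    constructor
    simp only [Q, Measure.smul_apply, Measure.finsetSum_apply, measure_univ, smul_eq_mul,
      Finset.sum_const, nsmul_eq_mul, mul_one]
    exact ENNReal.inv_mul_cancel (by simpa using hI.ne_empty) (ENNReal.natCast_ne_top _)
  obtain ⟨T, -, hcov, hlog⟩ := h.exists_cover hε hε1 Q hQ
  choose! p hp hpg using hcov
  exact ⟨T, p, hp, fun g hg =>
    (eLpNorm_two_empirical_le_iff I hI z (fun x => g x - p g x) hε.le).1 (hpg g hg), hlog⟩

end Entropy

/-! ### Chaining over dyadic scales -/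

section Chaining

theorem abs_radSign (b : Bool) : |radSign b| = 1 := by cases b <;> simp [radSign]

/-- The hypothesis carries 2k because a link of the chain ranges over pairs from two nets; log 2 is
absorbed by e^(-v) ≥ 1. -/
theorem sqrt_two_mul_log_le {N : ℕ} (hN : 0 < N) {k e v : ℝ} (hk : 0 ≤ k) (he : 0 < e)
    (he1 : e < 1) (hv : 0 < v) (h : Real.log N ≤ 2 * k * e ^ (-v)) :
    √(2 * Real.log (2 * N)) ≤ √(2 * (1 + 2 * k)) * e ^ (-(v / 2)) := by
  have h1 : 1 ≤ e ^ (-v) := Real.one_le_rpow_of_pos_of_le_one_of_nonpos he he1.le (by linarith)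
  have h2 : √(e ^ (-v)) = e ^ (-(v / 2)) := by
    rw [Real.sqrt_eq_rpow, ← Real.rpow_mul he.le]
    ring_nf
  rw [← h2, ← Real.sqrt_mul (by positivity)]
  apply Real.sqrt_le_sqrt
  rw [Real.log_mul (by norm_num) (by positivity)]
  have h3 : Real.log 2 ≤ 1 := by linarith [Real.log_two_lt_d9]
  nlinarith

variable {X : Type*} [MeasurableSpace X] [MeasurableSingletonClass X]

/-- The entropy bound for Rademacher averages, by chaining. -/
theorem UniformEntropyBound.exists_radMean_le {G : Set (X → ℝ)} {K v : ℝ}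
    (h : UniformEntropyBound G K v) (hv : 0 < v) (hv2 : v < 2) :
    ∃ C : ℝ, 0 ≤ C ∧ ∀ {ι : Type} [Fintype ι] [DecidableEq ι] (I : Finset ι), I.Nonempty →
      ∀ (z : ι → X) (τ : (ι → Bool) → X → ℝ), (∀ σ, τ σ ∈ G) →
        radMean (fun σ => |∑ i ∈ I, radSign (σ i) * τ σ (z i)|) ≤ C * √I.card := by
  classical
  obtain ⟨B, hB, hGB⟩ := h.exists_bound
  set k := max K 0 with hk
  have hk0 : 0 ≤ k := le_max_right _ _
  set D := √(2 * (1 + 2 * k)) with hD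
  have hD0 : 0 ≤ D := Real.sqrt_nonneg _
  -- At scale 2^(-(j+1)), radius times square root of entropy is of order ρ^(j+1); ρ < 1 amounts to
  -- v < 2.
  set ρ : ℝ := (1 / 2 : ℝ) ^ (1 - v / 2) with hρ
  have hρ0 : 0 < ρ := by positivity
  have hρ1 : ρ < 1 := Real.rpow_lt_one (by norm_num) (by norm_num) (by linarith)
  let e : ℕ → ℝ := fun j => (1 / 2) ^ (j + 1)
  have he0 : ∀ j, 0 < e j := fun j => by positivity
  have he1 : ∀ j, e j < 1 := fun j => pow_lt_one₀ (by norm_num) (by norm_num) (by omega)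
  have hes : ∀ j, 2 * e (j + 1) = e j := fun j => by simp only [e]; ring
  set A := (2 * B + 1) * (D * e 0 ^ (-(v / 2))) with hA
  have hA0 : 0 ≤ A := by have := he0 0; positivity
  have hlink : ∀ j, 4 * e (j + 1) * (D * e (j + 1) ^ (-(v / 2))) ≤ 4 * D * ρ ^ j := by
    intro j
    have h1 : e (j + 1) * e (j + 1) ^ (-(v / 2)) = ρ ^ (j + 2) := by
      conv_lhs => rw [← Real.rpow_one (e (j + 1))]
      rw [Real.rpow_one, ← Real.rpow_one_add' (he0 _).le (by linarith)]
      simp only [e, hρ]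
      rw [← Real.rpow_natCast, ← Real.rpow_natCast, ← Real.rpow_mul (by norm_num),
        ← Real.rpow_mul (by norm_num)]
      congr 1
      push_cast
      ring
    have h2 : ρ ^ (j + 2) ≤ ρ ^ j := pow_le_pow_of_le_one hρ0.le hρ1.le (by omega)
    calc _ = 4 * D * (e (j + 1) * e (j + 1) ^ (-(v / 2))) := by ring
      _ ≤ _ := by rw [h1]; gcongr
  refine ⟨A + 4 * D * (1 - ρ)⁻¹ + 1, ?_, ?_⟩
  · have : 0 < 1 - ρ := by linarith
    positivity
  intro ι _ _ I hI z τ hτ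
  have hm : (0 : ℝ) < I.card := by exact_mod_cast hI.card_pos
  have hsm : 0 < √(I.card : ℝ) := Real.sqrt_pos.2 hm
  have hsm2 : √(I.card : ℝ) ^ 2 = I.card := Real.sq_sqrt hm.le
  have hcov := fun j => h.exists_empirical_cover (he0 j) (he1 j) I hI z
  choose T p hpT hpe hlog using hcov
  have hlog' : ∀ j, Real.log (T j).card ≤ k * e j ^ (-v) := fun j =>
    (hlog j).trans (by have := he0 j; gcongr; exact le_max_left _ _)
  have h0 : radMean (fun σ => |∑ i ∈ I, radSign (σ i) * p 0 (τ σ) (z i)|) ≤ √I.card * A := by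
    -- Net elements may be far from the class, so only those of controlled norm are kept; the
    -- projections survive because 2(1/2)² + 2B² ≤ (2B + 1)².
    let T' := (T 0).filter fun t => ∑ i ∈ I, t (z i) ^ 2 ≤ (√I.card * (2 * B + 1)) ^ 2
    have hmem : ∀ σ, p 0 (τ σ) ∈ T' := by
      intro σ
      simp only [T', Finset.mem_filter]
      refine ⟨hpT 0 _ (hτ σ), ?_⟩
      have h1 := hpe 0 _ (hτ σ)
      have h2 : ∑ i ∈ I, (τ σ (z i)) ^ 2 ≤ I.card * B ^ 2 := by
        rw [← nsmul_eq_mul]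
        refine Finset.sum_le_card_nsmul _ _ _ fun i _ => ?_
        exact sq_le_sq' (abs_le.1 (hGB _ (hτ σ) _)).1 (abs_le.1 (hGB _ (hτ σ) _)).2
      calc ∑ i ∈ I, p 0 (τ σ) (z i) ^ 2
          ≤ ∑ i ∈ I, (2 * (τ σ (z i) - p 0 (τ σ) (z i)) ^ 2 + 2 * (τ σ (z i)) ^ 2) := by
            refine Finset.sum_le_sum fun i _ => ?_
            nlinarith [sq_nonneg ((τ σ (z i) - p 0 (τ σ) (z i)) + τ σ (z i))]
        _ ≤ 2 * (I.card * e 0 ^ 2) + 2 * (I.card * B ^ 2) := by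
            rw [Finset.sum_add_distrib, ← Finset.mul_sum, ← Finset.mul_sum]
            gcongr
        _ ≤ (√I.card * (2 * B + 1)) ^ 2 := by
            rw [mul_pow, hsm2]
            have : e 0 = 1 / 2 := by simp [e]
            rw [this]
            nlinarith
    have hcard : 0 < T'.card := Finset.card_pos.2 ⟨_, hmem fun _ => true⟩
    have hl : Real.log T'.card ≤ 2 * k * e 0 ^ (-v) := by
      have h1 : Real.log T'.card ≤ Real.log (T 0).card :=
        Real.log_le_log (by exact_mod_cast hcard) (by
          exact_mod_cast Finset.card_le_card (Finset.filter_subset _ _))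
      have h2 : 0 ≤ k * e 0 ^ (-v) := by have := he0 0; positivity
      linarith [hlog' 0]
    refine (radMean_abs_le_of_finite I T' (fun t i => t (z i)) (r := √I.card * (2 * B + 1))
      (by positivity) (fun t ht => (Finset.mem_filter.1 ht).2) (fun σ => p 0 (τ σ)) hmem).trans ?_
    rw [hA, ← mul_assoc]
    gcongr
    exact sqrt_two_mul_log_le hcard hk0 (he0 0) (he1 0) hv hl
  have hstep : ∀ j, radMean (fun σ => |∑ i ∈ I, radSign (σ i) *
      (p (j + 1) (τ σ) (z i) - p j (τ σ) (z i))|) ≤ √I.card * (4 * D * ρ ^ j) := by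
    intro j
    -- Consecutive projections differ by at most 4 e_{j+1}, since 2 e_{j+1}² + 2 e_j² = 10 e_{j+1}².
    let T' := (T (j + 1) ×ˢ T j).filter fun t =>
      ∑ i ∈ I, (t.1 (z i) - t.2 (z i)) ^ 2 ≤ (√I.card * (4 * e (j + 1))) ^ 2
    have hmem : ∀ σ, (p (j + 1) (τ σ), p j (τ σ)) ∈ T' := by
      intro σ
      simp only [T', Finset.mem_filter, Finset.mem_product]
      refine ⟨⟨hpT _ _ (hτ σ), hpT _ _ (hτ σ)⟩, ?_⟩
      have h1 := hpe j _ (hτ σ)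
      have h2 := hpe (j + 1) _ (hτ σ)
      calc ∑ i ∈ I, (p (j + 1) (τ σ) (z i) - p j (τ σ) (z i)) ^ 2
          ≤ ∑ i ∈ I, (2 * (τ σ (z i) - p (j + 1) (τ σ) (z i)) ^ 2
              + 2 * (τ σ (z i) - p j (τ σ) (z i)) ^ 2) := by
            refine Finset.sum_le_sum fun i _ => ?_
            nlinarith [sq_nonneg ((τ σ (z i) - p (j + 1) (τ σ) (z i))
              + (τ σ (z i) - p j (τ σ) (z i)))]
        _ ≤ 2 * (I.card * e (j + 1) ^ 2) + 2 * (I.card * e j ^ 2) := by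
            rw [Finset.sum_add_distrib, ← Finset.mul_sum, ← Finset.mul_sum]
            gcongr
        _ ≤ (√I.card * (4 * e (j + 1))) ^ 2 := by
            rw [mul_pow, hsm2, ← hes j]
            nlinarith [mul_pos hm (pow_pos (he0 (j + 1)) 2)]
    have hcard : 0 < T'.card := Finset.card_pos.2 ⟨_, hmem fun _ => true⟩
    have hl : Real.log T'.card ≤ 2 * k * e (j + 1) ^ (-v) := by
      have hpos : ∀ i, (0 : ℝ) < (T i).card := fun i => by
        exact_mod_cast Finset.card_pos.2 ⟨_, hpT i _ (hτ fun _ => true)⟩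
      have h1 : Real.log T'.card ≤ Real.log ((T (j + 1)).card * (T j).card) :=
        Real.log_le_log (by exact_mod_cast hcard) (by
          exact_mod_cast (Finset.card_le_card (Finset.filter_subset _ _)).trans
            (Finset.card_product _ _).le)
      rw [Real.log_mul (hpos _).ne' (hpos _).ne'] at h1
      have h2 : e j ^ (-v) ≤ e (j + 1) ^ (-v) :=
        Real.rpow_le_rpow_of_nonpos (he0 _) (by linarith [hes j, he0 (j + 1)]) (by linarith)
      have h3 := mul_le_mul_of_nonneg_left h2 hk0
      linarith [hlog' j, hlog' (j + 1)]
    have hpos := he0 (j + 1)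
    refine (radMean_abs_le_of_finite I T' (fun t i => t.1 (z i) - t.2 (z i))
      (r := √I.card * (4 * e (j + 1))) (by positivity) (fun t ht => (Finset.mem_filter.1 ht).2)
      (fun σ => (p (j + 1) (τ σ), p j (τ σ))) hmem).trans ?_
    refine (mul_le_mul_of_nonneg_left
      (sqrt_two_mul_log_le hcard hk0 (he0 _) (he1 _) hv hl) (by positivity)).trans ?_
    rw [mul_assoc]
    exact mul_le_mul_of_nonneg_left (hlink j) hsm.le
  have hadd : ∀ x y : (ι → Bool) → ι → ℝ,
      radMean (fun σ => |∑ i ∈ I, radSign (σ i) * x σ i|)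
        ≤ radMean (fun σ => |∑ i ∈ I, radSign (σ i) * y σ i|)
          + radMean (fun σ => |∑ i ∈ I, radSign (σ i) * (x σ i - y σ i)|) := by
    intro x y
    rw [← radMean_add]
    refine radMean_mono fun σ => ?_
    have : ∑ i ∈ I, radSign (σ i) * x σ i = ∑ i ∈ I, radSign (σ i) * y σ i
        + ∑ i ∈ I, radSign (σ i) * (x σ i - y σ i) := by
      rw [← Finset.sum_add_distrib]
      exact Finset.sum_congr rfl fun i _ => by ring
    rw [this]
    exact abs_add_le _ _
  have hJ : ∀ J : ℕ, radMean (fun σ => |∑ i ∈ I, radSign (σ i) * p J (τ σ) (z i)|)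
      ≤ √I.card * (A + 4 * D * ∑ j ∈ Finset.range J, ρ ^ j) := by
    intro J
    induction J with
    | zero => simpa using h0
    | succ J ih =>
      refine (hadd (fun σ i => p (J + 1) (τ σ) (z i)) (fun σ i => p J (τ σ) (z i))).trans ?_
      refine (add_le_add ih (hstep J)).trans_eq ?_
      rw [Finset.sum_range_succ]
      ring
  -- The chain stops once Cauchy–Schwarz bounds the remainder by |I| e_J ≤ √|I|. The depth depends
  -- on |I|, but the geometric series bounds the links uniformly.
  obtain ⟨J, hJm⟩ : ∃ J, e J * √I.card ≤ 1 := by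
    obtain ⟨J, hJ⟩ := exists_pow_lt_of_lt_one (inv_pos.2 hsm) (show (1 / 2 : ℝ) < 1 by norm_num)
    refine ⟨J, ?_⟩
    have h1 : e J ≤ (1 / 2 : ℝ) ^ J :=
      pow_le_pow_of_le_one (by norm_num) (by norm_num) (by omega)
    calc e J * √I.card ≤ (√I.card)⁻¹ * √I.card := by gcongr; exact h1.trans hJ.le
      _ = 1 := inv_mul_cancel₀ hsm.ne'
  have hlast : radMean (fun σ => |∑ i ∈ I, radSign (σ i) * (τ σ (z i) - p J (τ σ) (z i))|)
      ≤ √I.card := by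
    rw [← radMean_const (ι := ι) √I.card]
    refine radMean_mono fun σ => ?_
    have h1 : |∑ i ∈ I, radSign (σ i) * (τ σ (z i) - p J (τ σ) (z i))|
        ≤ ∑ i ∈ I, |τ σ (z i) - p J (τ σ) (z i)| := by
      refine (Finset.abs_sum_le_sum_abs _ _).trans_eq ?_
      exact Finset.sum_congr rfl fun i _ => by rw [abs_mul, abs_radSign, one_mul]
    refine h1.trans ?_
    have h2 := sq_sum_le_card_mul_sum_sq (s := I) (f := fun i => |τ σ (z i) - p J (τ σ) (z i)|)
    simp only [sq_abs] at h2
    have h3 : (∑ i ∈ I, |τ σ (z i) - p J (τ σ) (z i)|) ^ 2 ≤ (I.card * e J) ^ 2 := by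
      refine h2.trans ?_
      have := mul_le_mul_of_nonneg_left (hpe J _ (hτ σ)) hm.le
      linarith
    have h4 := abs_le_of_sq_le_sq h3 (by have := he0 J; positivity)
    have h5 : (I.card : ℝ) * e J ≤ √I.card := by
      calc (I.card : ℝ) * e J = √I.card * (e J * √I.card) := by
            rw [← hsm2]
            simp only [hsm2]
            nlinarith [hsm2]
        _ ≤ √I.card * 1 := by gcongr
        _ = √I.card := mul_one _
    exact (le_abs_self _).trans ((abs_of_nonneg (Finset.sum_nonneg fun _ _ => abs_nonneg _)).le.trans
      ((le_abs_self _).trans (h4.trans h5)))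
  have hgeom : ∑ j ∈ Finset.range J, ρ ^ j ≤ (1 - ρ)⁻¹ := by
    rw [← tsum_geometric_of_lt_one hρ0.le hρ1]
    exact (summable_geometric_of_lt_one hρ0.le hρ1).sum_le_tsum _ fun _ _ => by positivity
  refine (hadd (fun σ i => τ σ (z i)) (fun σ i => p J (τ σ) (z i))).trans ?_
  calc _ ≤ √I.card * (A + 4 * D * ∑ j ∈ Finset.range J, ρ ^ j) + √I.card :=
        add_le_add (hJ J) hlast
    _ ≤ √I.card * (A + 4 * D * (1 - ρ)⁻¹) + √I.card := by gcongr
    _ = _ := by ring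

end Chaining

/-! ### Symmetrization by exchange with a ghost sample -/

section Symmetrization

variable {Ω ι : Type*}

/-- Exchange the two components of a family of pairs at the indices in `I` with sign `false`. -/
def swapPairs [DecidableEq ι] (I : Finset ι) (σ : ι → Bool) (ω : ι → Ω × Ω) : ι → Ω × Ω :=
  fun i => if i ∈ I ∧ σ i = false then (ω i).swap else ω i

/-- The family of first components. -/
def firsts (ω : ι → Ω × Ω) : ι → Ω := fun i => (ω i).1

theorem firsts_swapPairs_of_notMem [DecidableEq ι] (I : Finset ι) (σ : ι → Bool) (ω : ι → Ω × Ω)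
    {i : ι} (hi : i ∉ I) : firsts (swapPairs I σ ω) i = firsts ω i := by
  simp [firsts, swapPairs, hi]

variable [MeasurableSpace Ω] [Fintype ι] (P : Measure Ω) [IsProbabilityMeasure P]

theorem measurePreserving_swapPairs [DecidableEq ι] (I : Finset ι) (σ : ι → Bool) :
    MeasurePreserving (swapPairs (Ω := Ω) I σ) (Measure.pi fun _ => P.prod P)
      (Measure.pi fun _ => P.prod P) := by
  refine measurePreserving_pi (fun _ => P.prod P) (fun _ => P.prod P)
    (f := fun i w => if i ∈ I ∧ σ i = false then w.swap else w) fun i => ?_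
  by_cases h : i ∈ I ∧ σ i = false
  · simp only [h, and_self, if_true]
    exact Measure.measurePreserving_swap
  · simp only [h, if_false]
    exact MeasurePreserving.id _

theorem measurePreserving_firsts :
    MeasurePreserving (firsts (Ω := Ω) (ι := ι)) (Measure.pi fun _ => P.prod P)
      (Measure.pi fun _ => P) :=
  measurePreserving_pi (fun _ => P.prod P) (fun _ => P) (f := fun _ w => w.1)
    fun _ => measurePreserving_fst

/-- The ghost observation at any index is independent of the whole first sample, so it can stand for
a fresh observation. -/
theorem measurePreserving_firsts_snd (i : ι) :
    MeasurePreserving (fun ω : ι → Ω × Ω => (firsts ω, (ω i).2)) (Measure.pi fun _ => P.prod P)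
      ((Measure.pi fun _ => P).prod P) :=
  ((MeasurePreserving.id (Measure.pi fun _ : ι => P)).prod
    (measurePreserving_eval (fun _ : ι => P) i)).comp
      (measurePreserving_arrowProdEquivProdArrow Ω Ω ι (fun _ => P) (fun _ => P))

/-- A property of a sample and an independent observation that depends on the sample only through
the indices outside `I` also holds at the observations with indices in `I`. -/
theorem ae_forall_mem_of_ae_ae [DecidableEq ι] (I : Finset ι) (p : (ι → Ω) → Ω → Prop)
    (hp : MeasurableSet {x : (ι → Ω) × Ω | p x.1 x.2})
    (hdep : ∀ D D' : ι → Ω, (∀ i ∉ I, D i = D' i) → ∀ o, p D o → p D' o)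
    (h : ∀ᵐ D ∂(Measure.pi fun _ : ι => P), ∀ᵐ o ∂P, p D o) :
    ∀ᵐ D ∂(Measure.pi fun _ : ι => P), ∀ i ∈ I, p D (D i) := by
  rw [← Measure.ae_prod_iff_ae_ae (p := fun x : (ι → Ω) × Ω => p x.1 x.2) hp] at h
  rw [ae_all_iff]
  intro i
  by_cases hi : i ∈ I
  swap
  · simp [hi]
  have h1 := (measurePreserving_firsts_snd P i).quasiMeasurePreserving.ae h
  -- Exchanging at every index of `I` moves the original observation `i` into the ghost place, while
  -- the sample outside `I`, on which alone `p` depends, is unchanged.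
  have h2 := (measurePreserving_swapPairs P I fun _ => false).quasiMeasurePreserving.ae h1
  have hm : MeasurableSet {D : ι → Ω | p D (D i)} :=
    hp.preimage (measurable_id.prodMk (measurable_pi_apply i))
  rw [← (measurePreserving_firsts P).map_eq, ae_map_iff
    (measurePreserving_firsts P).measurable.aemeasurable (by simpa [hi] using hm)]
  filter_upwards [h2] with ω hω _
  have e : (swapPairs I (fun _ => false) ω i).2 = firsts ω i := by simp [swapPairs, hi, firsts]
  rw [e] at hω
  exact hdep _ _ (fun j hj => firsts_swapPairs_of_notMem I _ ω hj) _ hω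

/-- Symmetrization for a data-dependent function: a bound on the average of the symmetrized
difference over all exchanges bounds the expected deviation. -/
theorem integral_deviation_le_of_swapPairs [DecidableEq ι] {I : Finset ι} (hI : I.Nonempty)
    {q : (ι → Ω) → Ω → ℝ} (hq : Measurable (Function.uncurry q)) {b : ℝ}
    (hb : ∀ D o, |q D o| ≤ b) {c : ℝ}
    (h : ∀ᵐ ω ∂(Measure.pi fun _ : ι => P.prod P), radMean (fun σ => ∑ i ∈ I,
      (q (firsts (swapPairs I σ ω)) (swapPairs I σ ω i).2
        - q (firsts (swapPairs I σ ω)) (swapPairs I σ ω i).1)) ≤ I.card * c) :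
    ∫ D, ((∫ o, q D o ∂P) - 1 / (I.card : ℝ) * ∑ i ∈ I, q D (D i))
      ∂(Measure.pi fun _ : ι => P) ≤ c := by
  have hm : (0 : ℝ) < I.card := by exact_mod_cast hI.card_pos
  have hqm : ∀ {β : Type _} [MeasurableSpace β] {f : β → ι → Ω} {g : β → Ω}, Measurable f →
      Measurable g → Measurable fun x => q (f x) (g x) := fun hf hg => hq.comp (hf.prodMk hg)
  have hint : ∀ {β : Type _} [MeasurableSpace β] (ν : Measure β) [IsProbabilityMeasure ν]
      {f : β → ι → Ω} {g : β → Ω}, Measurable f → Measurable g →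
      Integrable (fun x => q (f x) (g x)) ν := fun ν _ _ _ hf hg =>
    Integrable.of_bound (hqm hf hg).aestronglyMeasurable b (.of_forall fun x => hb _ _)
  have mf : Measurable (firsts (Ω := Ω) (ι := ι)) := (measurePreserving_firsts P).measurable
  have m1 : ∀ i, Measurable fun ω : ι → Ω × Ω => (ω i).1 := fun i =>
    measurable_fst.comp (measurable_pi_apply i)
  have m2 : ∀ i, Measurable fun ω : ι → Ω × Ω => (ω i).2 := fun i =>
    measurable_snd.comp (measurable_pi_apply i)
  -- Its mean is |I| times the expected deviation. An exchange also changes the sample on which `q`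
  -- is fitted, but the law of the pairs is invariant, so averaging over all exchanges leaves the
  -- mean as it is.
  let g : (ι → Ω × Ω) → ℝ := fun ω =>
    ∑ i ∈ I, (q (firsts ω) (ω i).2 - q (firsts ω) (ω i).1)
  have hgm : Measurable g :=
    Finset.measurable_fun_sum _ fun i _ => (hqm mf (m2 i)).sub (hqm mf (m1 i))
  have hgi : Integrable g (Measure.pi fun _ : ι => P.prod P) :=
    integrable_finsetSum _ fun i _ => (hint _ mf (m2 i)).sub (hint _ mf (m1 i))
  have hswap : ∀ σ, ∫ ω, g (swapPairs I σ ω) ∂(Measure.pi fun _ : ι => P.prod P)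
      = ∫ ω, g ω ∂(Measure.pi fun _ : ι => P.prod P) := by
    intro σ
    have := measurePreserving_swapPairs P I σ
    conv_rhs => rw [← this.map_eq]
    rw [integral_map this.measurable.aemeasurable hgm.aestronglyMeasurable]
  have hswapi : ∀ σ, Integrable (fun ω => g (swapPairs I σ ω))
      (Measure.pi fun _ : ι => P.prod P) := fun σ =>
    (measurePreserving_swapPairs P I σ).integrable_comp_of_integrable hgi
  have hle : ∫ ω, g ω ∂(Measure.pi fun _ : ι => P.prod P) ≤ I.card * c := by
    calc ∫ ω, g ω ∂(Measure.pi fun _ : ι => P.prod P)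
        = radMean (fun σ => ∫ ω, g (swapPairs I σ ω) ∂(Measure.pi fun _ : ι => P.prod P)) := by
          simp_rw [hswap]
          rw [radMean_const]
      _ = ∫ ω, radMean (fun σ => g (swapPairs I σ ω)) ∂(Measure.pi fun _ : ι => P.prod P) := by
          unfold radMean
          rw [integral_div, integral_finsetSum _ fun σ _ => hswapi σ]
      _ ≤ ∫ _, I.card * c ∂(Measure.pi fun _ : ι => P.prod P) := by
          refine integral_mono_ae ?_ (integrable_const _) h
          exact (integrable_finsetSum _ fun σ _ => hswapi σ).div_const _
      _ = I.card * c := by simp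
  have hsnd : ∀ i, ∫ ω, q (firsts ω) (ω i).2 ∂(Measure.pi fun _ : ι => P.prod P)
      = ∫ D, ∫ o, q D o ∂P ∂(Measure.pi fun _ : ι => P) := by
    intro i
    rw [← integral_prod (fun x : (ι → Ω) × Ω => q x.1 x.2) (hint _ measurable_fst measurable_snd),
      ← (measurePreserving_firsts_snd P i).map_eq,
      integral_map (measurePreserving_firsts_snd P i).measurable.aemeasurable
        (hqm measurable_fst measurable_snd).aestronglyMeasurable]
  have hfst : ∀ i, ∫ ω, q (firsts ω) (ω i).1 ∂(Measure.pi fun _ : ι => P.prod P)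
      = ∫ D, q D (D i) ∂(Measure.pi fun _ : ι => P) := by
    intro i
    conv_rhs => rw [← (measurePreserving_firsts P).map_eq]
    rw [integral_map (f := fun D => q D (D i)) mf.aemeasurable
      (hqm measurable_id (measurable_pi_apply i)).aestronglyMeasurable]
    rfl
  have hg : ∫ ω, g ω ∂(Measure.pi fun _ : ι => P.prod P)
      = I.card * ∫ D, ∫ o, q D o ∂P ∂(Measure.pi fun _ : ι => P)
        - ∑ i ∈ I, ∫ D, q D (D i) ∂(Measure.pi fun _ : ι => P) := by
    simp only [g]
    rw [integral_finsetSum (f := fun i ω => q (firsts ω) (ω i).2 - q (firsts ω) (ω i).1) _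
      fun i _ => (hint _ mf (m2 i)).sub (hint _ mf (m1 i))]
    simp_rw [fun i => integral_sub (hint (Measure.pi fun _ : ι => P.prod P) mf (m2 i))
      (hint _ mf (m1 i)), hsnd, hfst]
    rw [Finset.sum_sub_distrib, Finset.sum_const, nsmul_eq_mul]
  have hi1 : Integrable (fun D => ∫ o, q D o ∂P) (Measure.pi fun _ : ι => P) :=
    (hint ((Measure.pi fun _ : ι => P).prod P) measurable_fst measurable_snd).integral_prod_left
  have hi2 : ∀ i, Integrable (fun D => q D (D i)) (Measure.pi fun _ : ι => P) := fun i =>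
    hint _ measurable_id (measurable_pi_apply i)
  rw [integral_sub hi1 ((integrable_finsetSum _ fun i _ => hi2 i).const_mul _),
    integral_const_mul, integral_finsetSum _ fun i _ => hi2 i]
  rw [hg] at hle
  have := mul_le_mul_of_nonneg_left hle (inv_nonneg.2 hm.le)
  rw [inv_mul_cancel_left₀ hm.ne', mul_sub, inv_mul_cancel_left₀ hm.ne'] at this
  rwa [one_div]

end Symmetrization

/-! ### The weighted hinge loss and its stability in the end points -/

/-- The weighted hinge loss attached to an interval `[l, u]`. -/
noncomputable def weightedHinge (l u t : ℝ) : ℝ := weight l u * max (1 + label l u * t) 0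

theorem weight_nonneg (l u : ℝ) : 0 ≤ weight l u := by
  unfold weight
  positivity

theorem weight_le (l u : ℝ) : weight l u ≤ |l| + |u| := by
  unfold weight
  have h := abs_sub (|u|) (|l|)
  rw [abs_abs, abs_abs] at h
  have h1 := abs_nonneg l
  have h2 := abs_nonneg u
  split_ifs <;> first | (exfalso; linarith) | linarith

theorem abs_label_le (l u : ℝ) : |label l u| ≤ 1 := by
  unfold label sgn
  split_ifs <;> first | (exfalso; linarith [‹_ ∧ _›.1, ‹_ ∧ _›.2]) | norm_num

theorem weightedHinge_nonneg (l u t : ℝ) : 0 ≤ weightedHinge l u t :=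
  mul_nonneg (weight_nonneg l u) (le_max_right _ _)

theorem weightedHinge_zero (l u : ℝ) : weightedHinge l u 0 = weight l u := by
  simp [weightedHinge]

/-- The weighted hinge loss is Lipschitz in its last argument. -/
theorem abs_weightedHinge_sub_le {l u M : ℝ} (hl : |l| ≤ M) (hu : |u| ≤ M) (s t : ℝ) :
    |weightedHinge l u s - weightedHinge l u t| ≤ 2 * M * |s - t| := by
  unfold weightedHinge
  rw [← mul_sub, abs_mul, abs_of_nonneg (weight_nonneg l u)]
  have h1 := abs_max_sub_max_le_abs (1 + label l u * s) (1 + label l u * t) 0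
  have h2 : |1 + label l u * s - (1 + label l u * t)| ≤ |s - t| := by
    rw [add_sub_add_left_eq_sub, ← mul_sub, abs_mul]
    exact mul_le_of_le_one_left (abs_nonneg _) (abs_label_le l u)
  have h3 := weight_le l u
  have h0 := weight_nonneg l u
  exact mul_le_mul (by linarith) (h1.trans h2) (abs_nonneg _) (by linarith)

/-- The signed weight of an interval. -/
noncomputable def signedWeight (l u : ℝ) : ℝ := max (-l) 0 - max u 0

/-- Weight and label jump with the interval, but weight = |s| and weight · label = s for a signed
weight s that is Lipschitz in the end points. Only crossed intervals, with u < 0 < l, are excluded.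
-/
theorem weightedHinge_eq_signedWeight {l u : ℝ} (h : ¬(0 < l ∧ u < 0)) (t : ℝ) :
    weightedHinge l u t = max (|signedWeight l u| + signedWeight l u * t) 0 := by
  have key : weight l u = |signedWeight l u| ∧
      weight l u * label l u = signedWeight l u := by
    unfold weight label signedWeight sgn
    by_cases hl : 0 < l
    · have hu : 0 ≤ u := by
        by_contra hu
        exact h ⟨hl, not_le.1 hu⟩
      rw [max_eq_right (by linarith : -l ≤ 0), max_eq_left hu, if_pos hl,
        if_neg (not_lt.2 hu), if_neg (by intro h'; linarith [h'.1])]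
      simp [abs_of_nonneg hu]
    · by_cases hu : u < 0
      · rw [max_eq_left (by linarith : 0 ≤ -l), max_eq_right hu.le, if_neg hl, if_pos hu,
          if_neg (by intro h'; linarith [h'.2])]
        simp [abs_of_nonpos (not_lt.1 hl)]
      · rw [max_eq_left (by linarith : 0 ≤ -l), max_eq_left (not_lt.1 hu), if_neg hl, if_neg hu,
          if_pos ⟨not_lt.1 hl, not_lt.1 hu⟩, abs_of_nonpos (not_lt.1 hl),
          abs_of_nonneg (not_lt.1 hu)]
        constructor
        · rw [← abs_neg (-l - u)]
          simp only [mul_zero, zero_add, mul_one]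
          congr 1
          ring
        · split_ifs with h0
          · rw [abs_of_pos h0]; ring
          · rw [abs_of_nonpos (not_lt.1 h0)]; ring
  unfold weightedHinge
  rw [← key.1, mul_max_of_nonneg _ _ (weight_nonneg l u), mul_add, ← mul_assoc, key.2]
  simp

theorem abs_signedWeight_sub_le (l u l' u' : ℝ) :
    |signedWeight l' u' - signedWeight l u| ≤ |l' - l| + |u' - u| := by
  unfold signedWeight
  have h1 := abs_max_sub_max_le_abs (-l') (-l) 0
  have h2 := abs_max_sub_max_le_abs u' u 0
  rw [neg_sub_neg, abs_sub_comm l] at h1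
  calc |max (-l') 0 - max u' 0 - (max (-l) 0 - max u 0)|
      = |(max (-l') 0 - max (-l) 0) - (max u' 0 - max u 0)| := by congr 1; ring
    _ ≤ _ := (abs_sub _ _).trans (add_le_add h1 h2)

/-- Stability of the weighted hinge loss in the end points of the interval; the second interval
may be improper. -/
theorem abs_weightedHinge_sub_weightedHinge_le {l u : ℝ} (hlu : l ≤ u) (l' u' t : ℝ) :
    |weightedHinge l' u' t - weightedHinge l u t|
      ≤ 2 * (1 + |t|) * (|l' - l| + |u' - u|) := by
  have hproper : ¬(0 < l ∧ u < 0) := fun h => by linarith [h.1, h.2]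
  have hs := abs_signedWeight_sub_le l u l' u'
  rw [weightedHinge_eq_signedWeight hproper]
  have ht := abs_nonneg t
  have hδ : 0 ≤ |l' - l| + |u' - u| := by positivity
  by_cases h : 0 < l' ∧ u' < 0
  · obtain ⟨hl', hu'⟩ := h
    -- For a crossed interval the label is 0 and the loss is l' - u'. Since l ≤ u, both this value
    -- and |s| are at most the total end point error.
    have e : weightedHinge l' u' t = l' - u' := by
      unfold weightedHinge weight label
      rw [if_pos hl', if_pos hu', if_neg (by intro h'; linarith [h'.1])]
      simp [abs_of_pos hl', abs_of_neg hu']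
      ring
    have h1 : l' - u' ≤ |l' - l| + |u' - u| := by
      linarith [le_abs_self (l' - l), neg_abs_le (u' - u)]
    have h2 : |signedWeight l u| ≤ |l' - l| + |u' - u| := by
      unfold signedWeight
      have a1 : max (-l) 0 ≤ |l' - l| := max_le (by linarith [le_abs_self (l' - l)]) (abs_nonneg _)
      have a2 : max u 0 ≤ |u' - u| := max_le (by linarith [neg_abs_le (u' - u)]) (abs_nonneg _)
      have a3 := le_max_right (-l) 0
      have a4 := le_max_right u 0
      rw [abs_le]
      constructor <;> linarith [abs_nonneg (l' - l), abs_nonneg (u' - u)]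
    have h3 : max (|signedWeight l u| + signedWeight l u * t) 0
        ≤ (1 + |t|) * (|l' - l| + |u' - u|) := by
      refine max_le ?_ (by positivity)
      calc |signedWeight l u| + signedWeight l u * t
          ≤ |signedWeight l u| + |signedWeight l u| * |t| := by
            rw [← abs_mul]
            gcongr
            exact le_abs_self _
        _ = (1 + |t|) * |signedWeight l u| := by ring
        _ ≤ _ := by gcongr
    have h4 := le_max_right (|signedWeight l u| + signedWeight l u * t) 0
    have h5 : 0 ≤ |t| * (|l' - l| + |u' - u|) := by positivity
    rw [e, abs_le]
    constructor <;> nlinarith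
  · rw [weightedHinge_eq_signedWeight h]
    have h1 := abs_max_sub_max_le_abs (|signedWeight l' u'| + signedWeight l' u' * t)
      (|signedWeight l u| + signedWeight l u * t) 0
    refine h1.trans ?_
    have h2 : |signedWeight l' u'| + signedWeight l' u' * t
        - (|signedWeight l u| + signedWeight l u * t)
        = (|signedWeight l' u'| - |signedWeight l u|)
          + (signedWeight l' u' - signedWeight l u) * t := by ring
    rw [h2]
    refine (abs_add_le _ _).trans ?_
    rw [abs_mul]
    have h3 := (abs_abs_sub_abs_le (signedWeight l' u') (signedWeight l u)).trans hs
    have h4 := mul_le_mul_of_nonneg_right hs ht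
    nlinarith [mul_nonneg ht hδ]

/-! ### Closed forms of the worst-case loss and its surrogate -/

/-- The smallest possible value of the losses of the interval `[l, u]`. -/
noncomputable def minLoss (l u : ℝ) : ℝ := min (max (-l) 0) (max u 0)

theorem minLoss_nonneg (l u : ℝ) : 0 ≤ minLoss l u :=
  le_min (le_max_right _ _) (le_max_right _ _)

/-- A positive t errs exactly on c ≤ 0, where |c| is largest at l; any other t errs on c > 0, where
u is the worst case. -/
theorem upperLoss_eq {l u : ℝ} (hlu : l ≤ u) (t : ℝ) :
    upperLoss l u t = if 0 < t then max (-l) 0 else max u 0 := by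
  unfold upperLoss
  apply IsLUB.csSup_eq _ ((Set.nonempty_Icc.2 hlu).image _)
  refine ⟨?_, ?_⟩
  · rintro _ ⟨c, ⟨hc1, hc2⟩, rfl⟩
    by_cases ht : 0 < t <;> by_cases hc : 0 < c <;> simp only [sgn, ht, hc, if_true, if_false]
    · simp
    · norm_num [abs_of_nonpos (not_lt.1 hc)]
      left; exact hc1
    · norm_num [abs_of_pos hc]
      left; exact hc2
    · simp
  · intro b hb
    have hb' : ∀ c ∈ Set.Icc l u, (if sgn t ≠ sgn c then |c| else 0) ≤ b := fun c hc =>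
      hb ⟨c, hc, rfl⟩
    have hb0 : 0 ≤ b := by
      refine le_trans ?_ (hb' l ⟨le_rfl, hlu⟩)
      split_ifs <;> positivity
    by_cases ht : 0 < t
    · rw [if_pos ht]
      refine max_le ?_ hb0
      by_cases hl : 0 < l
      · linarith
      · have := hb' l ⟨le_rfl, hlu⟩
        simp only [sgn, ht, hl, if_true, if_false] at this
        norm_num [abs_of_nonpos (not_lt.1 hl)] at this
        linarith
    · rw [if_neg ht]
      refine max_le ?_ hb0
      by_cases hu : 0 < u
      · have := hb' u ⟨hlu, le_rfl⟩
        simp only [sgn, ht, hu, if_true, if_false] at this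
        norm_num [abs_of_pos hu] at this
        exact this
      · linarith

theorem minLoss_le_upperLoss {l u : ℝ} (hlu : l ≤ u) (t : ℝ) : minLoss l u ≤ upperLoss l u t := by
  rw [upperLoss_eq hlu]
  unfold minLoss
  split_ifs
  exacts [min_le_left _ _, min_le_right _ _]

theorem surrogateLoss_eq {l u : ℝ} (hlu : l ≤ u) (t : ℝ) :
    surrogateLoss l u t = minLoss l u + max (|signedWeight l u| + signedWeight l u * t) 0 := by
  unfold surrogateLoss minLoss signedWeight hinge
  by_cases hl : 0 < l
  · have hu : 0 < u := by linarith
    rw [if_pos hl, max_eq_right (by linarith : -l ≤ 0), max_eq_left hu.le, min_eq_left hu.le,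
      zero_sub, abs_neg, abs_of_pos hu, mul_max_of_nonneg _ _ hu.le]
    simp only [mul_zero, zero_add]
    congr 1
    ring
  · rw [if_neg hl, max_eq_left (by linarith : 0 ≤ -l), abs_of_nonpos (not_lt.1 hl)]
    by_cases hu : u < 0
    · rw [if_pos hu, max_eq_right hu.le, min_eq_right (by linarith), sub_zero,
        abs_of_nonneg (by linarith : 0 ≤ -l), mul_max_of_nonneg _ _ (by linarith)]
      simp only [mul_zero, zero_add]
      congr 1
      ring
    · rw [if_neg hu, max_eq_left (not_lt.1 hu), abs_of_nonneg (not_lt.1 hu)]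
      split_ifs with h
      · rw [min_eq_left h, mul_max_of_nonneg _ _ (by linarith),
          abs_of_nonpos (by linarith : -l - u ≤ 0)]
        simp only [mul_zero]
        congr 2
        ring
      · rw [min_eq_right (by linarith), mul_max_of_nonneg _ _ (by linarith),
          abs_of_nonneg (by linarith : 0 ≤ -l - u)]
        simp only [mul_zero]
        congr 2
        ring

theorem surrogateLoss_eq_weightedHinge {l u : ℝ} (hlu : l ≤ u) (t : ℝ) :
    surrogateLoss l u t = minLoss l u + weightedHinge l u t := by
  rw [surrogateLoss_eq hlu, weightedHinge_eq_signedWeight]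
  exact fun h => by linarith [h.1, h.2]

/-- With a = (-l)⁺ and b = u⁺, the worst-case loss is min(a, b), plus |a - b| on the wrong side;
there (a - b) t ≥ 0, so the hinge part is at least |a - b|. -/
theorem upperLoss_le_surrogateLoss {l u : ℝ} (hlu : l ≤ u) (t : ℝ) :
    upperLoss l u t ≤ surrogateLoss l u t := by
  rw [upperLoss_eq hlu, surrogateLoss_eq hlu]
  unfold minLoss signedWeight
  generalize max (-l) 0 = a
  generalize max u 0 = b
  have h0 := le_max_right (|a - b| + (a - b) * t) 0
  have h1 := le_max_left (|a - b| + (a - b) * t) 0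
  rcases le_total a b with h | h
  · rw [min_eq_left h]
    split_ifs with ht
    · linarith
    · rw [abs_of_nonpos (by linarith)] at h1
      have := mul_nonneg_of_nonpos_of_nonpos (sub_nonpos.2 h) (not_lt.1 ht)
      rw [abs_of_nonpos (by linarith)] at h0 ⊢
      linarith
  · rw [min_eq_right h]
    split_ifs with ht
    · rw [abs_of_nonneg (by linarith)] at h1
      have := mul_nonneg (sub_nonneg.2 h) ht.le
      rw [abs_of_nonneg (by linarith)] at h0 ⊢
      linarith
    · linarith

/-- At t = ±1 opposed to the signed weight the hinge part vanishes, so the lower bound is attained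
by an explicit rule. -/
theorem surrogateLoss_neg_sign {l u : ℝ} (hlu : l ≤ u) :
    surrogateLoss l u (if 0 ≤ signedWeight l u then -1 else 1) = minLoss l u := by
  rw [surrogateLoss_eq hlu]
  split_ifs with h
  · rw [abs_of_nonneg h]
    simp
  · rw [abs_of_nonpos (not_le.1 h).le]
    simp

/-! ### Comparison of the two risks -/

section Risk

variable {X : Type*} [MeasurableSpace X] {μ : Measure X} {L U : X → ℝ}

/-- The integral of `minLoss` separates the two: a measurable ±1-valued rule attains it for the
surrogate, and it lies below every worst-case risk. -/
theorem bayesSurrogateRisk_le_bayesUpperRisk (hL : Measurable L) (hU : Measurable U)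
    (hLU : ∀ᵐ x ∂μ, L x ≤ U x) : bayesSurrogateRisk μ L U ≤ bayesUpperRisk μ L U := by
  have h1 : bayesSurrogateRisk μ L U ≤ ∫⁻ x, ENNReal.ofReal (minLoss (L x) (U x)) ∂μ := by
    refine (iInf₂_le (fun x => if 0 ≤ signedWeight (L x) (U x) then -1 else 1) ?_).trans ?_
    · refine Measurable.ite (measurableSet_le measurable_const ?_) measurable_const
        measurable_const
      exact (hL.neg.max measurable_const).sub (hU.max measurable_const)
    · refine (lintegral_congr_ae ?_).le
      filter_upwards [hLU] with x hx
      rw [surrogateLoss_neg_sign hx]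
  refine h1.trans (le_iInf₂ fun f _ => lintegral_mono_ae ?_)
  filter_upwards [hLU] with x hx
  exact ENNReal.ofReal_le_ofReal (minLoss_le_upperLoss hx _)

theorem upperRisk_le_surrogateRisk (hLU : ∀ᵐ x ∂μ, L x ≤ U x) (f : X → ℝ) :
    upperRisk μ L U f ≤ surrogateRisk μ L U f := by
  refine lintegral_mono_ae ?_
  filter_upwards [hLU] with x hx
  exact ENNReal.ofReal_le_ofReal (upperLoss_le_surrogateLoss hx _)

theorem classSurrogateRisk_le (hL : Measurable L) (hU : Measurable U)
    (hLU : ∀ᵐ x ∂μ, L x ≤ U x) (F : Set (X → ℝ)) :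
    classSurrogateRisk μ L U F ≤ bayesUpperRisk μ L U + approxError μ L U F :=
  le_add_tsub.trans (add_le_add_left (bayesSurrogateRisk_le_bayesUpperRisk hL hU hLU) _)

theorem Measurable.sgn {α : Type*} [MeasurableSpace α] {f : α → ℝ} (hf : Measurable f) :
    Measurable fun x => sgn (f x) :=
  Measurable.ite (measurableSet_lt measurable_const hf) measurable_const measurable_const

theorem Measurable.weightedHinge {α : Type*} [MeasurableSpace α] {l u t : α → ℝ}
    (hl : Measurable l) (hu : Measurable u) (ht : Measurable t) :
    Measurable fun x => weightedHinge (l x) (u x) (t x) := by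
  have m1 : Measurable fun x => if 0 < l x then (1 : ℝ) else 0 :=
    Measurable.ite (measurableSet_lt measurable_const hl) measurable_const measurable_const
  have m2 : Measurable fun x => if u x < 0 then (1 : ℝ) else 0 :=
    Measurable.ite (measurableSet_lt hu measurable_const) measurable_const measurable_const
  have m3 : Measurable fun x => if l x ≤ 0 ∧ 0 ≤ u x then (1 : ℝ) else 0 :=
    Measurable.ite ((measurableSet_le hl measurable_const).inter
      (measurableSet_le measurable_const hu)) measurable_const measurable_const
  have m4 : Measurable fun x => |u x| - |l x| := hu.abs.sub hl.abs
  unfold _root_.weightedHinge weight label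
  exact (((hu.abs.mul m1).add (hl.abs.mul m2)).add (m4.abs.mul m3)).mul
    ((measurable_const.add (((m2.sub m1).sub (m4.sgn.mul m3)).mul ht)).max measurable_const)

end Risk

/-! ### Truncation, and Rademacher bounds for Lipschitz losses -/

/-- Truncation of a real number to `[-M, M]`. -/
noncomputable def clip (M t : ℝ) : ℝ := max (-M) (min M t)

theorem abs_clip_le {M : ℝ} (hM : 0 ≤ M) (t : ℝ) : |clip M t| ≤ M :=
  abs_le.2 ⟨le_max_left _ _, max_le (by linarith) (min_le_left _ _)⟩

theorem clip_eq_self {M t : ℝ} (h : |t| ≤ M) : clip M t = t := by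
  unfold clip
  rw [min_eq_right (abs_le.1 h).2, max_eq_right (abs_le.1 h).1]

theorem abs_clip_sub_clip_le (M s t : ℝ) : |clip M s - clip M t| ≤ |s - t| := by
  unfold clip
  calc |max (-M) (min M s) - max (-M) (min M t)| ≤ |min M s - min M t| := by
        refine (abs_max_sub_max_le_max _ _ _ _).trans ?_
        rw [sub_self, abs_zero]
        exact max_le (abs_nonneg _) le_rfl
    _ ≤ |s - t| := by
        refine (abs_min_sub_min_le_max _ _ _ _).trans ?_
        rw [sub_self, abs_zero]
        exact max_le (abs_nonneg _) le_rfl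

theorem Measurable.clip {α : Type*} [MeasurableSpace α] {f : α → ℝ} (hf : Measurable f) (M : ℝ) :
    Measurable fun x => clip M (f x) :=
  measurable_const.max (measurable_const.min hf)

theorem abs_weightedHinge_le {l u M : ℝ} (hl : |l| ≤ M) (hu : |u| ≤ M) (t : ℝ) :
    |weightedHinge l u t| ≤ 2 * M * (1 + |t|) := by
  have h := abs_weightedHinge_sub_le hl hu t 0
  rw [weightedHinge_zero, sub_zero] at h
  have h1 : |weight l u| ≤ 2 * M := by
    rw [abs_of_nonneg (weight_nonneg l u)]
    linarith [weight_le l u]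
  calc |weightedHinge l u t| = |(weightedHinge l u t - weight l u) + weight l u| := by
        rw [sub_add_cancel]
    _ ≤ _ := (abs_add_le _ _).trans (by linarith)

/-- The constant `C` bounds the normalized Rademacher averages of the class `G`. -/
def RademacherBound {X : Type*} (G : Set (X → ℝ)) (C : ℝ) : Prop :=
  ∀ {ι : Type} [Fintype ι] [DecidableEq ι] (I : Finset ι), I.Nonempty →
    ∀ (z : ι → X) (τ : (ι → Bool) → X → ℝ), (∀ σ, τ σ ∈ G) →
      radMean (fun σ => |∑ i ∈ I, radSign (σ i) * τ σ (z i)|) ≤ C * √I.card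

/-- The sign patterns index the vectors of the contraction principle. It makes the sum linear in the
selected function, so that the scalar `a` factors out. -/
theorem RademacherBound.radMean_lipschitz_le {X : Type*} {G : Set (X → ℝ)} {C : ℝ}
    (hG : RademacherBound G C) {ι : Type} [Fintype ι] [DecidableEq ι] {I : Finset ι}
    (hI : I.Nonempty) (z : ι → X) {ψ : ι → ℝ → ℝ} {W : ℝ} (hW : 0 ≤ W)
    (hψ : ∀ i ∈ I, ∀ s t, |ψ i s - ψ i t| ≤ W * |s - t|) {A : ℝ} (hA : 0 ≤ A)
    (f : (ι → Bool) → X → ℝ) (hf : ∀ σ, ∃ g ∈ G, ∃ a : ℝ, |a| ≤ A ∧ f σ = a • g) :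
    radMean (fun σ => ∑ i ∈ I, radSign (σ i) * ψ i (f σ (z i))) ≤ W * (A * (C * √I.card)) := by
  obtain ⟨τ, -, hτ⟩ := exists_selection_contraction I (fun σ i => f σ (z i)) ψ hψ id
  refine hτ.trans (mul_le_mul_of_nonneg_left ?_ hW)
  choose g hg a ha hfa using hf
  refine le_trans ?_ (mul_le_mul_of_nonneg_left (hG I hI z (fun σ => g (τ σ)) fun σ => hg _) hA)
  rw [← radMean_const_mul]
  refine radMean_mono fun σ => ?_
  have e : ∑ i ∈ I, radSign (σ i) * f (τ σ) (z i)
      = a (τ σ) * ∑ i ∈ I, radSign (σ i) * g (τ σ) (z i) := by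
    rw [Finset.mul_sum, hfa (τ σ)]
    exact Finset.sum_congr rfl fun i _ => by simp only [Pi.smul_apply, smul_eq_mul]; ring
  rw [e]
  refine (le_abs_self _).trans ?_
  rw [abs_mul]
  gcongr
  exact ha _

/-! ### Deviation bound and oracle inequality for a fixed partition -/

section Deviation

variable {d : ℕ} {𝒳 : Set (Fin d → ℝ)}

/-- The difference of the truncated plug-in losses of a data-dependent function and of a fixed
one. -/
noncomputable def lossDiff {ι : Type*} (M R : ℝ) (lh uh fh : (ι → Obs 𝒳) → 𝒳 → ℝ) (g : 𝒳 → ℝ)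
    (D : ι → Obs 𝒳) (x : 𝒳) : ℝ :=
  weightedHinge (clip M (lh D x)) (clip M (uh D x)) (clip R (fh D x))
    - weightedHinge (clip M (lh D x)) (clip M (uh D x)) (g x)

theorem measurable_lossDiff {n : ℕ} (M R : ℝ) {lh uh fh : (Fin n → Obs 𝒳) → 𝒳 → ℝ} {g : 𝒳 → ℝ}
    (hlh : Measurable (Function.uncurry lh)) (huh : Measurable (Function.uncurry uh))
    (hfh : Measurable (Function.uncurry fh)) (hg : Measurable g) :
    Measurable (Function.uncurry (lossDiff M R lh uh fh g)) :=
  ((hlh.clip M).weightedHinge (huh.clip M) (hfh.clip R)).sub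
    ((hlh.clip M).weightedHinge (huh.clip M) (hg.comp measurable_snd))

theorem abs_lossDiff_le {n : ℕ} {M R R' : ℝ} (hM : 0 ≤ M) (hR : 0 ≤ R)
    (lh uh fh : (Fin n → Obs 𝒳) → 𝒳 → ℝ) {g : 𝒳 → ℝ} (hgR : ∀ x, |g x| ≤ R')
    (D : Fin n → Obs 𝒳) (x : 𝒳) : |lossDiff M R lh uh fh g D x| ≤ 2 * M * (R + R') := by
  refine (abs_weightedHinge_sub_le (abs_clip_le hM _) (abs_clip_le hM _) _ _).trans ?_
  gcongr
  exact (abs_sub _ _).trans (add_le_add (abs_clip_le hR _) (hgR x))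

variable (P : Measure (Obs 𝒳))

theorem integral_covLaw {f : 𝒳 → ℝ} (hf : Measurable f) :
    ∫ x, f x ∂(covLaw P) = ∫ o, f o.1 ∂P :=
  integral_map measurable_fst.aemeasurable hf.aestronglyMeasurable

variable [IsProbabilityMeasure P]

instance covLaw.instIsProbabilityMeasure : IsProbabilityMeasure (covLaw P) :=
  Measure.isProbabilityMeasure_map measurable_fst.aemeasurable

set_option maxHeartbeats 1000000 in
/-- The expected deviation between population and empirical excess loss of a data-dependent
function from the multiples of a class with bounded Rademacher averages. -/
theorem integral_lossDiff_deviation_le {n : ℕ} {I : Finset (Fin n)} (hI : I.Nonempty)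
    {M R R' : ℝ} (hM : 0 ≤ M) (hR : 0 ≤ R) {lh uh fh : (Fin n → Obs 𝒳) → 𝒳 → ℝ} {g : 𝒳 → ℝ}
    (hlh : Measurable (Function.uncurry lh)) (huh : Measurable (Function.uncurry uh))
    (hfh : Measurable (Function.uncurry fh)) (hg : Measurable g) (hgR : ∀ x, |g x| ≤ R')
    (hlh_dep : ∀ D D' : Fin n → Obs 𝒳, (∀ i ∉ I, D i = D' i) → lh D = lh D')
    (huh_dep : ∀ D D' : Fin n → Obs 𝒳, (∀ i ∉ I, D i = D' i) → uh D = uh D')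
    {G : Set (𝒳 → ℝ)} {C A : ℝ} (hG : RademacherBound G C) (hA : 0 ≤ A)
    (hfG : ∀ᵐ D ∂(Measure.pi fun _ : Fin n => P), ∃ f ∈ G, ∃ a : ℝ, |a| ≤ A ∧ fh D = a • f) :
    ∫ D, ((∫ x, lossDiff M R lh uh fh g D x ∂(covLaw P))
        - 1 / (I.card : ℝ) * ∑ i ∈ I, lossDiff M R lh uh fh g D (D i).1)
      ∂(Measure.pi fun _ : Fin n => P) ≤ 4 * M * (A * C) / √I.card := by
  have hm : (0 : ℝ) < I.card := by exact_mod_cast hI.card_pos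
  have hq := measurable_lossDiff M R hlh huh hfh hg
  have hqx : ∀ D, Measurable (lossDiff M R lh uh fh g D) := fun D =>
    hq.comp (measurable_const.prodMk measurable_id)
  simp_rw [integral_covLaw P (hqx _)]
  refine integral_deviation_le_of_swapPairs P hI
    (q := fun D o => lossDiff M R lh uh fh g D o.1)
    (hq.comp (measurable_fst.prodMk (measurable_fst.comp measurable_snd)))
    (fun D o => abs_lossDiff_le hM hR lh uh fh hgR D o.1) ?_
  -- There are finitely many exchanges, so one null set serves all refitted functions.
  have hgood : ∀ᵐ ω ∂(Measure.pi fun _ : Fin n => P.prod P), ∀ σ : Fin n → Bool,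
      ∃ f ∈ G, ∃ a : ℝ, |a| ≤ A ∧ fh (firsts (swapPairs I σ ω)) = a • f := by
    rw [ae_all_iff]
    intro σ
    exact ((measurePreserving_firsts P).comp
      (measurePreserving_swapPairs P I σ)).quasiMeasurePreserving.ae hfG
  filter_upwards [hgood] with ω hω
  -- Sample splitting enters here: exchanges within `I` do not affect `lh` and `uh`, so one loss
  -- serves all patterns and only `fh` is refitted. Truncation at `R` is 1-Lipschitz, hence the
  -- Lipschitz constant 2M is free of `R`.
  let φ : 𝒳 → ℝ → ℝ := fun x t =>
    weightedHinge (clip M (lh (firsts ω) x)) (clip M (uh (firsts ω) x)) (clip R t)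
      - weightedHinge (clip M (lh (firsts ω) x)) (clip M (uh (firsts ω) x)) (g x)
  have hφ : ∀ x s t, |φ x s - φ x t| ≤ 2 * M * |s - t| := by
    intro x s t
    simp only [φ, sub_sub_sub_cancel_right]
    refine (abs_weightedHinge_sub_le (abs_clip_le hM _) (abs_clip_le hM _) _ _).trans ?_
    exact mul_le_mul_of_nonneg_left (abs_clip_sub_clip_le R s t) (by positivity)
  have hφq : ∀ σ x, lossDiff M R lh uh fh g (firsts (swapPairs I σ ω)) x
      = φ x (fh (firsts (swapPairs I σ ω)) x) := by
    intro σ x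
    unfold lossDiff
    rw [hlh_dep _ (firsts ω) fun i hi => firsts_swapPairs_of_notMem I σ ω hi,
      huh_dep _ (firsts ω) fun i hi => firsts_swapPairs_of_notMem I σ ω hi]
  have e : ∀ σ, ∑ i ∈ I, (lossDiff M R lh uh fh g (firsts (swapPairs I σ ω)) (swapPairs I σ ω i).2.1
        - lossDiff M R lh uh fh g (firsts (swapPairs I σ ω)) (swapPairs I σ ω i).1.1)
      = ∑ i ∈ I, radSign (σ i) * φ (ω i).2.1 (fh (firsts (swapPairs I σ ω)) (ω i).2.1)
        + ∑ i ∈ I, radSign (σ i) * -φ (ω i).1.1 (fh (firsts (swapPairs I σ ω)) (ω i).1.1) := by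
    intro σ
    rw [← Finset.sum_add_distrib]
    refine Finset.sum_congr rfl fun i hi => ?_
    rw [hφq, hφq]
    cases h : σ i
    · have : swapPairs I σ ω i = (ω i).swap := by simp [swapPairs, hi, h]
      rw [this]
      simp [radSign]
      ring
    · have : swapPairs I σ ω i = ω i := by simp [swapPairs, h]
      rw [this]
      simp [radSign]
      ring
  simp_rw [e]
  rw [radMean_add]
  -- The ghost points and the sample points are bounded separately, which doubles 2M to 4M.
  have h1 := hG.radMean_lipschitz_le hI (fun i => (ω i).2.1) (ψ := fun i => φ (ω i).2.1)
    (W := 2 * M) (by positivity) (fun i _ => hφ _) hA _ hω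
  have h2 := hG.radMean_lipschitz_le hI (fun i => (ω i).1.1) (ψ := fun i t => -φ (ω i).1.1 t)
    (W := 2 * M) (by positivity)
    (fun i _ s t => by rw [neg_sub_neg, abs_sub_comm]; exact hφ _ s t) hA _ hω
  refine (add_le_add h1 h2).trans_eq ?_
  have hs : √(I.card : ℝ) ≠ 0 := (Real.sqrt_pos.2 hm).ne'
  field_simp
  rw [Real.sq_sqrt hm.le]
  ring

/-- The oracle inequality for the expected surrogate risk of a data-dependent function, for one
fixed partition of the sample. -/
theorem lintegral_surrogateRisk_le {n : ℕ} {I : Finset (Fin n)} (hI : I.Nonempty)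
    {L U : 𝒳 → ℝ} (hL : Measurable L) (hU : Measurable U)
    (hLU : ∀ᵐ x ∂(covLaw P), L x ≤ U x)
    {M R R' : ℝ} (hM : 0 ≤ M) (hR : 0 ≤ R) (hLUM : ∀ᵐ x ∂(covLaw P), |L x| ≤ M ∧ |U x| ≤ M)
    {lh uh fh : (Fin n → Obs 𝒳) → 𝒳 → ℝ} {g : 𝒳 → ℝ}
    (hlh : Measurable (Function.uncurry lh)) (huh : Measurable (Function.uncurry uh))
    (hfh : Measurable (Function.uncurry fh)) (hg : Measurable g) (hgR : ∀ x, |g x| ≤ R')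
    (hlh_dep : ∀ D D' : Fin n → Obs 𝒳, (∀ i ∉ I, D i = D' i) → lh D = lh D')
    (huh_dep : ∀ D D' : Fin n → Obs 𝒳, (∀ i ∉ I, D i = D' i) → uh D = uh D')
    {G : Set (𝒳 → ℝ)} {C A r : ℝ} (hG : RademacherBound G C) (hA : 0 ≤ A)
    (hfG : ∀ᵐ D ∂(Measure.pi fun _ : Fin n => P), ∃ f ∈ G, ∃ a : ℝ, |a| ≤ A ∧ fh D = a • f)
    (hfR : ∀ᵐ D ∂(Measure.pi fun _ : Fin n => P), ∀ x, |fh D x| ≤ R)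
    (hhM : ∀ᵐ D ∂(Measure.pi fun _ : Fin n => P), ∀ᵐ x ∂(covLaw P), |lh D x| ≤ M ∧ |uh D x| ≤ M)
    (hhMI : ∀ᵐ D ∂(Measure.pi fun _ : Fin n => P), ∀ i ∈ I,
      |lh D (D i).1| ≤ M ∧ |uh D (D i).1| ≤ M)
    (hemp : ∀ᵐ D ∂(Measure.pi fun _ : Fin n => P), 1 / (I.card : ℝ) * ∑ i ∈ I,
        weightedHinge (lh D (D i).1) (uh D (D i).1) (fh D (D i).1)
      ≤ 1 / (I.card : ℝ) * ∑ i ∈ I, weightedHinge (lh D (D i).1) (uh D (D i).1) (g (D i).1) + r) :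
    ∫⁻ D, surrogateRisk (covLaw P) L U (fh D) ∂(Measure.pi fun _ : Fin n => P)
      ≤ surrogateRisk (covLaw P) L U g + ENNReal.ofReal (r + 4 * M * (A * C) / √I.card)
        + ENNReal.ofReal (2 * (2 + R + R')) *
          (∫⁻ D, ∫⁻ x, ENNReal.ofReal |lh D x - L x| ∂(covLaw P) ∂(Measure.pi fun _ : Fin n => P)
          + ∫⁻ D, ∫⁻ x, ENNReal.ofReal |uh D x - U x| ∂(covLaw P)
            ∂(Measure.pi fun _ : Fin n => P)) := by
  set ν := Measure.pi fun _ : Fin n => P with hν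
  set μ := covLaw P with hμ
  -- Stability of the loss is used twice, at `fh` and at `g`: 2(1 + R) + 2(1 + R').
  set c := 2 * (2 + R + R') with hc
  have hne : Nonempty 𝒳 := by
    obtain ⟨o⟩ := P.nonempty_of_neZero
    exact ⟨o.1⟩
  have hR' : 0 ≤ R' := (abs_nonneg _).trans (hgR hne.some)
  have hc0 : 0 ≤ c := by positivity
  let q := lossDiff M R lh uh fh g
  have hq : Measurable (Function.uncurry q) := measurable_lossDiff M R hlh huh hfh hg
  have hqb : ∀ D x, |q D x| ≤ 2 * M * (R + R') := abs_lossDiff_le hM hR lh uh fh hgR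
  -- Truncation makes `s`, `q` and `e` bounded for every sample, hence integrable; it is inactive
  -- almost surely on the quantities compared below.
  let s : 𝒳 → ℝ := fun x => minLoss (clip M (L x)) (clip M (U x))
    + weightedHinge (clip M (L x)) (clip M (U x)) (g x)
  have hsm : Measurable s := by
    refine Measurable.add ?_ ((hL.clip M).weightedHinge (hU.clip M) hg)
    exact ((hL.clip M).neg.max measurable_const).min ((hU.clip M).max measurable_const)
  have hs0 : ∀ x, 0 ≤ s x := fun x => add_nonneg (minLoss_nonneg _ _) (weightedHinge_nonneg _ _ _)
  have hsi : Integrable s μ := by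
    refine Integrable.of_bound hsm.aestronglyMeasurable (M + 2 * M * (1 + R'))
      (.of_forall fun x => ?_)
    rw [Real.norm_eq_abs]
    refine (abs_add_le _ _).trans (add_le_add ?_ ?_)
    · rw [abs_of_nonneg (minLoss_nonneg _ _)]
      exact (min_le_right _ _).trans
        (max_le ((le_abs_self _).trans (abs_clip_le hM _)) hM)
    · refine (abs_weightedHinge_le (abs_clip_le hM _) (abs_clip_le hM _) _).trans ?_
      gcongr
      exact hgR x
  let e : (Fin n → Obs 𝒳) → 𝒳 → ℝ := fun D x =>
    |clip M (lh D x) - clip M (L x)| + |clip M (uh D x) - clip M (U x)|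
  have hem : Measurable (Function.uncurry e) :=
    ((hlh.clip M).sub ((hL.comp measurable_snd).clip M)).abs.add
      ((huh.clip M).sub ((hU.comp measurable_snd).clip M)).abs
  have he0 : ∀ D x, 0 ≤ e D x := fun D x => by positivity
  have heb : ∀ D x, |e D x| ≤ 4 * M := by
    intro D x
    rw [abs_of_nonneg (he0 D x)]
    have h1 := (abs_sub (clip M (lh D x)) (clip M (L x))).trans
      (add_le_add (abs_clip_le hM _) (abs_clip_le hM _))
    have h2 := (abs_sub (clip M (uh D x)) (clip M (U x))).trans
      (add_le_add (abs_clip_le hM _) (abs_clip_le hM _))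
    simp only [e]
    linarith
  have hsec : ∀ {β : Type} [MeasurableSpace β] {f : (Fin n → Obs 𝒳) → 𝒳 → β}, Measurable (Function.uncurry f) →
      ∀ D, Measurable (f D) := fun hf D => hf.comp (measurable_const.prodMk measurable_id)
  have hqi : ∀ D, Integrable (q D) μ := fun D =>
    Integrable.of_bound (hsec hq D).aestronglyMeasurable _ (.of_forall (hqb D))
  have hei : ∀ D, Integrable (e D) μ := fun D =>
    Integrable.of_bound (hsec hem D).aestronglyMeasurable _ (.of_forall (heb D))
  have hqI : Integrable (fun D => ∫ x, q D x ∂μ) ν :=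
    (Integrable.of_bound (μ := ν.prod μ) hq.aestronglyMeasurable _
      (.of_forall fun x => hqb x.1 x.2)).integral_prod_left
  have heI : Integrable (fun D => ∫ x, e D x ∂μ) ν :=
    (Integrable.of_bound (μ := ν.prod μ) hem.aestronglyMeasurable _
      (.of_forall fun x => heb x.1 x.2)).integral_prod_left
  have hqD : Integrable (fun D => 1 / (I.card : ℝ) * ∑ i ∈ I, q D (D i).1) ν := by
    refine (integrable_finsetSum _ fun i _ => ?_).const_mul _
    exact Integrable.of_bound (hq.comp (measurable_id.prodMk
      (measurable_fst.comp (measurable_pi_apply i)))).aestronglyMeasurable _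
      (.of_forall fun D => hqb D (D i).1)
  let Δ : (Fin n → Obs 𝒳) → ℝ := fun D =>
    (∫ x, q D x ∂μ) - 1 / (I.card : ℝ) * ∑ i ∈ I, q D (D i).1
  have hΔ : Integrable Δ ν := hqI.sub hqD
  have hΔle : ∫ D, Δ D ∂ν ≤ 4 * M * (A * C) / √I.card :=
    integral_lossDiff_deviation_le P hI hM hR hlh huh hfh hg hgR hlh_dep huh_dep hG hA hfG
  -- The deviation `Δ` may be negative, so the bound is integrated as a real function; its
  -- nonnegativity almost everywhere is what permits the return to `[0, ∞]`.
  let E : (Fin n → Obs 𝒳) → ℝ := fun D => (∫ x, s x ∂μ) + r + Δ D + c * ∫ x, e D x ∂μ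
  have hE : Integrable E ν := ((integrable_const _).add hΔ).add (heI.const_mul c)
  have hsg : surrogateRisk μ L U g = ENNReal.ofReal (∫ x, s x ∂μ) := by
    rw [ofReal_integral_eq_lintegral_ofReal hsi (.of_forall hs0)]
    refine lintegral_congr_ae ?_
    filter_upwards [hLU, hLUM] with x hx hxM
    simp only [s, clip_eq_self hxM.1, clip_eq_self hxM.2]
    rw [surrogateLoss_eq_weightedHinge hx]
  have hD : ∀ᵐ D ∂ν, surrogateRisk μ L U (fh D) ≤ ENNReal.ofReal (E D) ∧ 0 ≤ E D := by
    filter_upwards [hfR, hhM, hhMI, hemp] with D hfR hhM hhMI hemp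
    -- The loss passes from true to fitted end points at `fh` and back at `g`; the two stability
    -- errors add up to `c * e D x`.
    have hpt : ∀ᵐ x ∂μ, surrogateLoss (L x) (U x) (fh D x) ≤ s x + q D x + c * e D x := by
      filter_upwards [hLU, hLUM, hhM] with x hx hxM hxh
      rw [surrogateLoss_eq_weightedHinge hx]
      simp only [s, q, e, lossDiff, clip_eq_self hxM.1, clip_eq_self hxM.2, clip_eq_self hxh.1,
        clip_eq_self hxh.2, clip_eq_self (hfR x)]
      have h1 := (abs_le.1 (abs_weightedHinge_sub_weightedHinge_le hx (lh D x) (uh D x)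
        (fh D x))).1
      have h2 := (abs_le.1 (abs_weightedHinge_sub_weightedHinge_le hx (lh D x) (uh D x)
        (g x))).2
      set δ := |lh D x - L x| + |uh D x - U x|
      have hδ : 0 ≤ δ := by positivity
      have h3 := mul_le_mul_of_nonneg_right (hfR x) hδ
      have h4 := mul_le_mul_of_nonneg_right (hgR x) hδ
      rw [hc]
      linarith
    have hi : Integrable (fun x => s x + q D x + c * e D x) μ :=
      (hsi.add (hqi D)).add ((hei D).const_mul c)
    have hnn : ∀ᵐ x ∂μ, 0 ≤ s x + q D x + c * e D x := by
      filter_upwards [hpt, hLU] with x hx hxLU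
      refine le_trans ?_ hx
      rw [surrogateLoss_eq_weightedHinge hxLU]
      exact add_nonneg (minLoss_nonneg _ _) (weightedHinge_nonneg _ _ _)
    have hval : ∫ x, (s x + q D x + c * e D x) ∂μ
        = (∫ x, s x ∂μ) + (∫ x, q D x ∂μ) + c * ∫ x, e D x ∂μ := by
      rw [integral_add (f := fun x => s x + q D x) (hsi.add (hqi D)) ((hei D).const_mul c),
        integral_add hsi (hqi D), integral_const_mul]
    have hqe : 1 / (I.card : ℝ) * ∑ i ∈ I, q D (D i).1 ≤ r := by
      have : ∑ i ∈ I, q D (D i).1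
          = ∑ i ∈ I, weightedHinge (lh D (D i).1) (uh D (D i).1) (fh D (D i).1)
            - ∑ i ∈ I, weightedHinge (lh D (D i).1) (uh D (D i).1) (g (D i).1) := by
        rw [← Finset.sum_sub_distrib]
        refine Finset.sum_congr rfl fun i hi => ?_
        simp only [q, lossDiff, clip_eq_self (hhMI i hi).1, clip_eq_self (hhMI i hi).2,
          clip_eq_self (hfR _)]
      rw [this, mul_sub]
      linarith
    have hEle : ∫ x, (s x + q D x + c * e D x) ∂μ ≤ E D := by
      rw [hval]
      simp only [E, Δ]
      linarith
    refine ⟨?_, (integral_nonneg_of_ae hnn).trans hEle⟩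
    refine le_trans ?_ (ENNReal.ofReal_le_ofReal hEle)
    rw [ofReal_integral_eq_lintegral_ofReal hi hnn]
    refine lintegral_mono_ae ?_
    filter_upwards [hpt] with x hx
    exact ENNReal.ofReal_le_ofReal hx
  have hEint : ∫ D, E D ∂ν
      = (∫ x, s x ∂μ) + r + (∫ D, Δ D ∂ν) + c * ∫ D, ∫ x, e D x ∂μ ∂ν := by
    simp only [E]
    rw [integral_add (f := fun D => (∫ x, s x ∂μ) + r + Δ D)
      ((integrable_const _).add hΔ) (heI.const_mul c),
      integral_add (integrable_const _) hΔ, integral_const_mul]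
    simp
  have hEe : ENNReal.ofReal (∫ D, ∫ x, e D x ∂μ ∂ν)
      ≤ ∫⁻ D, ∫⁻ x, ENNReal.ofReal |lh D x - L x| ∂μ ∂ν
        + ∫⁻ D, ∫⁻ x, ENNReal.ofReal |uh D x - U x| ∂μ ∂ν := by
    rw [ofReal_integral_eq_lintegral_ofReal heI
      (.of_forall fun D => integral_nonneg (he0 D))]
    have m1 : Measurable fun z : (Fin n → Obs 𝒳) × 𝒳 => ENNReal.ofReal |lh z.1 z.2 - L z.2| :=
      (hlh.sub (hL.comp measurable_snd)).abs.ennreal_ofReal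
    rw [← lintegral_add_left (Measurable.lintegral_prod_right' m1)]
    refine lintegral_mono_ae ?_
    filter_upwards [hhM] with D hhM
    rw [ofReal_integral_eq_lintegral_ofReal (hei D) (.of_forall (he0 D)),
      ← lintegral_add_left (hsec (f := fun D x => ENNReal.ofReal |lh D x - L x|) m1 D)]
    refine lintegral_mono_ae ?_
    filter_upwards [hhM, hLUM] with x h1 h2
    simp only [e, clip_eq_self h1.1, clip_eq_self h1.2, clip_eq_self h2.1, clip_eq_self h2.2]
    exact ENNReal.ofReal_add_le
  calc ∫⁻ D, surrogateRisk μ L U (fh D) ∂ν ≤ ∫⁻ D, ENNReal.ofReal (E D) ∂ν :=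
        lintegral_mono_ae (hD.mono fun D h => h.1)
    _ = ENNReal.ofReal (∫ D, E D ∂ν) :=
        (ofReal_integral_eq_lintegral_ofReal hE (hD.mono fun D h => h.2)).symm
    _ ≤ ENNReal.ofReal ((∫ x, s x ∂μ) + (r + 4 * M * (A * C) / √I.card)
          + c * ∫ D, ∫ x, e D x ∂μ ∂ν) := by
        apply ENNReal.ofReal_le_ofReal
        rw [hEint]
        linarith
    _ ≤ ENNReal.ofReal (∫ x, s x ∂μ) + ENNReal.ofReal (r + 4 * M * (A * C) / √I.card)
          + ENNReal.ofReal (c * ∫ D, ∫ x, e D x ∂μ ∂ν) :=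
        ENNReal.ofReal_add_le.trans (add_le_add ENNReal.ofReal_add_le le_rfl)
    _ ≤ _ := by
        rw [hsg, ENNReal.ofReal_mul hc0]
        gcongr

end Deviation

/-! ### The estimator and the final rate -/

theorem empObjective_eq {d : ℕ} {𝒳 : Set (Fin d → ℝ)} (Lhat Uhat : FirstHalfRule 𝒳) (lam : ℝ)
    {n : ℕ} (I₁ : Finset (Fin n)) (D : Fin n → Obs 𝒳) (f : 𝒳 → ℝ) (pen : ℝ) :
    empObjective Lhat Uhat lam I₁ D f pen = 1 / (I₁ᶜ.card : ℝ) * ∑ i ∈ I₁ᶜ,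
      weightedHinge (fitted Lhat I₁ D (D i).1) (fitted Uhat I₁ D (D i).1) (f (D i).1)
        + lam / 2 * pen ^ 2 := rfl

theorem measurable_fitted {d : ℕ} {𝒳 : Set (Fin d → ℝ)} {G : FirstHalfRule 𝒳}
    (hG : ∀ (n : ℕ) (I₁ : Finset (Fin n)),
      Measurable fun p : (I₁ → Obs 𝒳) × 𝒳 => G n I₁ p.1 p.2) {n : ℕ} (I₁ : Finset (Fin n)) :
    Measurable (Function.uncurry fun (D : Fin n → Obs 𝒳) => fitted G I₁ D) := by
  refine (hG n I₁).comp (Measurable.prodMk ?_ measurable_snd)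
  exact measurable_pi_lambda _ fun i => (measurable_pi_apply _).comp measurable_fst

theorem fitted_congr {d : ℕ} {𝒳 : Set (Fin d → ℝ)} (G : FirstHalfRule 𝒳) {n : ℕ}
    (I₁ : Finset (Fin n)) (D D' : Fin n → Obs 𝒳) (h : ∀ i ∉ I₁ᶜ, D i = D' i) :
    fitted G I₁ D = fitted G I₁ D' := by
  have : (fun i : I₁ => D i) = fun i : I₁ => D' i := funext fun i => h i (by simp)
  simp only [fitted, this]

theorem proposition5
    {d : ℕ} (𝒳 : Set (Fin d → ℝ))
    -- the law of one observation `(X, Z, A, Y)`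
    (P : Measure (Obs 𝒳)) [IsProbabilityMeasure P]
    -- the partial identification interval `[L(x), U(x)]`
    (L U : 𝒳 → ℝ) (hL : Measurable L) (hU : Measurable U)
    (hLU : ∀ᵐ x ∂(covLaw P), L x ≤ U x)
    -- a normed space `H` of functions, and the class `F` of measurable discriminant functions
    (H : Submodule ℝ (𝒳 → ℝ)) (N : Seminorm ℝ H) (hN : ∀ f : H, N f = 0 → f = 0)
    (F : Set H) (hF : ∀ f ∈ F, Measurable (f : 𝒳 → ℝ))
    -- the random partition of the indices into `I₁` and `I₂ = I₁ᶜ`, both of order `n`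
    (split : (n : ℕ) → PMF (Finset (Fin n)))
    (hsplit : ∃ c : ℝ, 0 < c ∧ ∀ᶠ n : ℕ in atTop, ∀ I₁ ∈ (split n).support,
      c * n ≤ (I₁.card : ℝ) ∧ c * n ≤ (I₁ᶜ.card : ℝ))
    -- the estimators of `L` and `U` from the observations in `I₁`
    (Lhat Uhat : FirstHalfRule 𝒳)
    (hLhat : ∀ (n : ℕ) (I₁ : Finset (Fin n)),
      Measurable fun p : (I₁ → Obs 𝒳) × 𝒳 => Lhat n I₁ p.1 p.2)
    (hUhat : ∀ (n : ℕ) (I₁ : Finset (Fin n)),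
      Measurable fun p : (I₁ → Obs 𝒳) × 𝒳 => Uhat n I₁ p.1 p.2)
    -- the tuning parameters
    (lam : ℕ → ℝ) (hlam_pos : ∀ᶠ n in atTop, 0 < lam n) (hlam : Tendsto lam atTop (𝓝 0))
    -- the sample-splitting estimator: a measurable choice of a minimizer over `F`
    (fhat : (n : ℕ) → Finset (Fin n) → (Fin n → Obs 𝒳) → H)
    (hfhat : ∀ (n : ℕ) (I₁ : Finset (Fin n)),
      Measurable fun p : (Fin n → Obs 𝒳) × 𝒳 => (fhat n I₁ p.1 : 𝒳 → ℝ) p.2)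
    (hfhat_min : ∀ᶠ n in atTop, SampleAE P (split n) fun I₁ D =>
      fhat n I₁ D ∈ F ∧ ∀ f ∈ F,
        empObjective Lhat Uhat (lam n) I₁ D (fhat n I₁ D : 𝒳 → ℝ) (N (fhat n I₁ D)) ≤
          empObjective Lhat Uhat (lam n) I₁ D (f : 𝒳 → ℝ) (N f))
    -- existence of a minimizer of the surrogate risk in `F`
    (hA1 : ∃ f ∈ F, surrogateRisk (covLaw P) L U (f : 𝒳 → ℝ) =
      classSurrogateRisk (covLaw P) L U ((fun f : H => (f : 𝒳 → ℝ)) '' F))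
    -- boundedness of `L`, `U`, `Y` and of the covariates
    (hA2 : (∃ M₁ : ℝ, 0 < M₁ ∧ ∀ᵐ o ∂P, |L o.1| ≤ M₁ ∧ |U o.1| ≤ M₁ ∧ |o.2.2.2| ≤ M₁) ∧
      ∃ M₂ : ℝ, ∀ᵐ o ∂P, ∀ i : Fin d, |(o.1 : Fin d → ℝ) i| ≤ M₂)
    -- boundedness of the estimators of `L` and `U` at an independent covariate
    (hA3 : ∃ M₃ : ℝ, ∀ᶠ n in atTop, SampleAE P (split n) fun I₁ D => ∀ᵐ x ∂(covLaw P),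
      |fitted Lhat I₁ D x| ≤ M₃ ∧ |fitted Uhat I₁ D x| ≤ M₃)
    -- entropy condition
    (hA4 : ∃ (F₀ : Set H) (C₀ v K : ℝ), F₀ ⊆ F ∧ 0 < C₀ ∧ 0 < v ∧ v < 2 ∧
      F = {g : H | ∃ f ∈ F₀, ∃ a : ℝ, g = a • f} ∧
      (∀ᶠ n in atTop, SampleAE P (split n) fun I₁ D =>
        ∃ f ∈ F₀, ∃ a : ℝ, |a| ≤ C₀ * (lam n)⁻¹ ∧ fhat n I₁ D = a • f) ∧
      UniformEntropyBound ((fun f : H => (f : 𝒳 → ℝ)) '' F₀) K v)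
    -- rates of convergence of the estimators of `L` and `U`
    (α β : ℝ)
    (hA5 : (∃ K : ℝ, ∀ᶠ n : ℕ in atTop,
        sampleExp P (split n) (fun I₁ D =>
          ∫⁻ x, ENNReal.ofReal |fitted Lhat I₁ D x - L x| ∂(covLaw P)) ≤
            ENNReal.ofReal (K * (n : ℝ) ^ (-α))) ∧
      ∃ K : ℝ, ∀ᶠ n : ℕ in atTop,
        sampleExp P (split n) (fun I₁ D =>
          ∫⁻ x, ENNReal.ofReal |fitted Uhat I₁ D x - U x| ∂(covLaw P)) ≤
            ENNReal.ofReal (K * (n : ℝ) ^ (-β)))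
    -- the norm dominates the supremum norm on `F`
    (hA6 : ∃ M₄ : ℝ, 0 < M₄ ∧ ∀ f ∈ F, ∀ x : 𝒳, M₄ * |(f : 𝒳 → ℝ) x| ≤ N f) :
    ∃ C : ℝ, ∀ᶠ n : ℕ in atTop,
      sampleExp P (split n) (fun I₁ D =>
          upperRisk (covLaw P) L U (fhat n I₁ D : 𝒳 → ℝ)) ≤
        bayesUpperRisk (covLaw P) L U
          + approxError (covLaw P) L U ((fun f : H => (f : 𝒳 → ℝ)) '' F)
          + ENNReal.ofReal (C * (lam n + (n : ℝ) ^ (-(1 / 2) : ℝ) * (lam n)⁻¹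
              + (lam n) ^ (-(1 / 2) : ℝ) * ((n : ℝ) ^ (-α) + (n : ℝ) ^ (-β)))) := by
  classical
  obtain ⟨c₀, hc₀, hsplit⟩ := hsplit
  obtain ⟨g, hgF, hgmin⟩ := hA1
  obtain ⟨⟨M₁, hM₁, hA2⟩, -⟩ := hA2
  obtain ⟨M₃, hA3⟩ := hA3
  obtain ⟨F₀, C₀, v, K, hF₀, hC₀, hv, hv2, hFeq, hfhatF₀, hent⟩ := hA4
  obtain ⟨⟨K₁, hK₁⟩, K₂, hK₂⟩ := hA5
  obtain ⟨M₄, hM₄, hA6⟩ := hA6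
  obtain ⟨C, hC, hrad⟩ := hent.exists_radMean_le hv hv2
  set μ := covLaw P with hμ
  set M := max M₁ M₃ with hM
  have hM0 : 0 < M := lt_max_of_lt_left hM₁
  have hLUM : ∀ᵐ x ∂μ, |L x| ≤ M ∧ |U x| ≤ M := by
    have hms : MeasurableSet {x : 𝒳 | |L x| ≤ M ∧ |U x| ≤ M} :=
      (measurableSet_le hL.abs measurable_const).inter (measurableSet_le hU.abs measurable_const)
    rw [hμ, covLaw, ae_map_iff measurable_fst.aemeasurable hms]
    filter_upwards [hA2] with o ho
    exact ⟨ho.1.trans (le_max_left _ _), ho.2.1.trans (le_max_left _ _)⟩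
  have h0F : (0 : H) ∈ F := by
    have hgF' := hgF
    rw [hFeq] at hgF' ⊢
    obtain ⟨f, hf, -⟩ := hgF'
    exact ⟨f, hf, 0, by simp⟩
  set R' := N g / M₄ with hR'
  have hgR : ∀ x, |(g : 𝒳 → ℝ) x| ≤ R' := fun x => by
    rw [hR', le_div_iff₀ hM₄, mul_comm]
    exact hA6 g hgF x
  have hR'0 : 0 ≤ R' := div_nonneg (apply_nonneg N g) hM₄.le
  -- Comparison with 0 gives (λ/2)‖f̂‖² ≤ 2M, hence a sup norm of at most √(4M/λ)/M₄ = ρ λ^(-1/2).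
  set ρ := √(4 * M) / M₄ with hρ
  have hρ0 : 0 ≤ ρ := by positivity
  -- The constants of the end point rates may be negative; their positive parts let `ENNReal.ofReal`
  -- commute with sums and products.
  set k₁ := max K₁ 0 with hk₁
  set k₂ := max K₂ 0 with hk₂
  have hk₁0 : 0 ≤ k₁ := le_max_right _ _
  have hk₂0 : 0 ≤ k₂ := le_max_right _ _
  have hlam1 : ∀ᶠ n in atTop, lam n < 1 := hlam.eventually_lt_const (by norm_num)
  -- The summands come from the penalty of `g`, the deviation bound with |I₂| ≥ c₀ n, and the end
  -- point errors.
  refine ⟨N g ^ 2 / 2 + 4 * M * C₀ * C / √c₀ + 2 * (2 + ρ + R') * (k₁ + k₂), ?_⟩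
  filter_upwards [hsplit, hlam_pos, hfhat_min, hA3, hfhatF₀, hK₁, hK₂, hlam1,
    eventually_gt_atTop 0] with n hsplit hlam hmin hA3 hF₀n hK₁ hK₂ hlam1 hn
  have hn0 : (0 : ℝ) < n := by exact_mod_cast hn
  set l := lam n with hl
  set R := ρ * l ^ (-(1 / 2) : ℝ) with hR
  have hl2 : 0 < l ^ (-(1 / 2) : ℝ) := by positivity
  have hR0 : 0 ≤ R := by positivity
  have hsqrt : √(4 * M / l) / M₄ = R := by
    rw [hR, hρ, Real.sqrt_div (by positivity), Real.rpow_neg hlam.le, ← Real.sqrt_eq_rpow]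
    field_simp
  have hpart : ∀ I₁ ∈ (split n).support,
      ∫⁻ D, surrogateRisk μ L U (fhat n I₁ D : 𝒳 → ℝ) ∂(Measure.pi fun _ : Fin n => P)
        ≤ surrogateRisk μ L U (g : 𝒳 → ℝ)
          + ENNReal.ofReal (l / 2 * N g ^ 2 + 4 * M * (C₀ * l⁻¹ * C) / √(c₀ * n))
          + ENNReal.ofReal (2 * (2 + R + R')) *
          (∫⁻ D, ∫⁻ x, ENNReal.ofReal |fitted Lhat I₁ D x - L x| ∂μ
              ∂(Measure.pi fun _ : Fin n => P)
          + ∫⁻ D, ∫⁻ x, ENNReal.ofReal |fitted Uhat I₁ D x - U x| ∂μ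
              ∂(Measure.pi fun _ : Fin n => P)) := by
    intro I₁ hI₁
    have hcard := (hsplit I₁ hI₁).2
    have hcn : 0 < c₀ * n := by positivity
    have hm : (0 : ℝ) < I₁ᶜ.card := hcn.trans_le hcard
    have hI : I₁ᶜ.Nonempty := Finset.card_pos.1 (by exact_mod_cast hm)
    have hhM : ∀ᵐ D ∂(Measure.pi fun _ : Fin n => P), ∀ᵐ x ∂μ,
        |fitted Lhat I₁ D x| ≤ M ∧ |fitted Uhat I₁ D x| ≤ M := by
      filter_upwards [hA3 I₁ hI₁] with D hD
      filter_upwards [hD] with x hx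
      exact ⟨hx.1.trans (le_max_right _ _), hx.2.trans (le_max_right _ _)⟩
    have hmL := measurable_fitted hLhat I₁
    have hmU := measurable_fitted hUhat I₁
    -- Boundedness is given at an independent covariate; it passes to the observations in I₂ because
    -- the fit uses only those in I₁.
    have hhMI : ∀ᵐ D ∂(Measure.pi fun _ : Fin n => P), ∀ i ∈ I₁ᶜ,
        |fitted Lhat I₁ D (D i).1| ≤ M ∧ |fitted Uhat I₁ D (D i).1| ≤ M := by
      refine ae_forall_mem_of_ae_ae P I₁ᶜ
        (fun D o => |fitted Lhat I₁ D o.1| ≤ M ∧ |fitted Uhat I₁ D o.1| ≤ M) ?_ ?_ ?_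
      · have hp : Measurable fun x : (Fin n → Obs 𝒳) × Obs 𝒳 => (x.1, x.2.1) :=
          measurable_fst.prodMk (measurable_fst.comp measurable_snd)
        exact (measurableSet_le (hmL.comp hp).abs measurable_const).inter
          (measurableSet_le (hmU.comp hp).abs measurable_const)
      · intro D D' hDD' o ho
        rwa [fitted_congr Lhat I₁ D D' hDD', fitted_congr Uhat I₁ D D' hDD'] at ho
      · filter_upwards [hhM] with D hD
        exact ae_of_ae_map measurable_fst.aemeasurable hD
    have hfR : ∀ᵐ D ∂(Measure.pi fun _ : Fin n => P), ∀ x, |(fhat n I₁ D : 𝒳 → ℝ) x| ≤ R := by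
      filter_upwards [hmin I₁ hI₁, hhMI] with D hD hDM x
      have h1 := hD.2 0 h0F
      rw [empObjective_eq, empObjective_eq] at h1
      have h2 : 1 / (I₁ᶜ.card : ℝ) * ∑ i ∈ I₁ᶜ, weightedHinge (fitted Lhat I₁ D (D i).1)
          (fitted Uhat I₁ D (D i).1) (((0 : H) : 𝒳 → ℝ) (D i).1) ≤ 2 * M := by
        rw [one_div, inv_mul_le_iff₀ hm, ← nsmul_eq_mul]
        refine Finset.sum_le_card_nsmul _ _ _ fun i hi => ?_
        have e : ((0 : H) : 𝒳 → ℝ) (D i).1 = 0 := rfl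
        rw [e, weightedHinge_zero]
        refine (weight_le _ _).trans ?_
        linarith [(hDM i hi).1, (hDM i hi).2]
      have h3 : 0 ≤ 1 / (I₁ᶜ.card : ℝ) * ∑ i ∈ I₁ᶜ, weightedHinge (fitted Lhat I₁ D (D i).1)
          (fitted Uhat I₁ D (D i).1) ((fhat n I₁ D : 𝒳 → ℝ) (D i).1) :=
        mul_nonneg (by positivity) (Finset.sum_nonneg fun i _ => weightedHinge_nonneg _ _ _)
      have h4 : N (fhat n I₁ D) ^ 2 ≤ 4 * M / l := by
        rw [map_zero] at h1
        rw [le_div_iff₀ hlam]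
        linarith
      have h5 := Real.le_sqrt_of_sq_le h4
      rw [← hsqrt, le_div_iff₀ hM₄, mul_comm]
      exact (hA6 _ hD.1 x).trans h5
    have hemp : ∀ᵐ D ∂(Measure.pi fun _ : Fin n => P), 1 / (I₁ᶜ.card : ℝ) * ∑ i ∈ I₁ᶜ,
          weightedHinge (fitted Lhat I₁ D (D i).1) (fitted Uhat I₁ D (D i).1)
            ((fhat n I₁ D : 𝒳 → ℝ) (D i).1)
        ≤ 1 / (I₁ᶜ.card : ℝ) * ∑ i ∈ I₁ᶜ, weightedHinge (fitted Lhat I₁ D (D i).1)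
            (fitted Uhat I₁ D (D i).1) ((g : 𝒳 → ℝ) (D i).1) + l / 2 * N g ^ 2 := by
      filter_upwards [hmin I₁ hI₁] with D hD
      have h1 := hD.2 g hgF
      rw [empObjective_eq, empObjective_eq] at h1
      have h2 : 0 ≤ l / 2 * N (fhat n I₁ D) ^ 2 := by positivity
      linarith
    have hfG : ∀ᵐ D ∂(Measure.pi fun _ : Fin n => P),
        ∃ f ∈ (fun f : H => (f : 𝒳 → ℝ)) '' F₀, ∃ a : ℝ, |a| ≤ C₀ * l⁻¹ ∧
          (fhat n I₁ D : 𝒳 → ℝ) = a • f := by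
      filter_upwards [hF₀n I₁ hI₁] with D hD
      obtain ⟨f, hf, a, ha, hfa⟩ := hD
      exact ⟨f, ⟨f, hf, rfl⟩, a, ha, by rw [hfa]; rfl⟩
    refine (lintegral_surrogateRisk_le P (fh := fun D => (fhat n I₁ D : 𝒳 → ℝ)) hI hL hU hLU hM0.le hR0 hLUM hmL hmU (hfhat n I₁)
      (hF g hgF) hgR (fitted_congr Lhat I₁) (fitted_congr Uhat I₁) hrad (by positivity) hfG hfR hhM
      hhMI hemp).trans ?_
    gcongr
  have hsum1 : ∑ I₁ : Finset (Fin n), split n I₁ = 1 := by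
    have h := PMF.tsum_coe (split n)
    rwa [tsum_fintype] at h
  set rate := l / 2 * N g ^ 2 + 4 * M * (C₀ * l⁻¹ * C) / √(c₀ * n) with hrate
  have hrisk : sampleExp P (split n) (fun I₁ D => upperRisk μ L U (fhat n I₁ D : 𝒳 → ℝ))
      ≤ surrogateRisk μ L U (g : 𝒳 → ℝ) + ENNReal.ofReal rate
        + ENNReal.ofReal (2 * (2 + R + R')) *
          (ENNReal.ofReal (K₁ * (n : ℝ) ^ (-α)) + ENNReal.ofReal (K₂ * (n : ℝ) ^ (-β))) := by
    refine le_trans ?_ (add_le_add le_rfl (mul_le_mul_right (add_le_add hK₁ hK₂) _))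
    unfold sampleExp
    -- The terms free of the partition are spread over all partitions by their probabilities, which
    -- sum to 1.
    rw [← one_mul (surrogateRisk μ L U (g : 𝒳 → ℝ) + ENNReal.ofReal rate), ← hsum1,
      Finset.sum_mul, ← Finset.sum_add_distrib, Finset.mul_sum, ← Finset.sum_add_distrib]
    refine Finset.sum_le_sum fun I₁ _ => ?_
    by_cases hI₁ : I₁ ∈ (split n).support
    · refine (mul_le_mul_right ((lintegral_mono fun D =>
        upperRisk_le_surrogateRisk hLU _).trans (hpart I₁ hI₁)) _).trans_eq ?_
      ring
    · have : split n I₁ = 0 := by simpa [PMF.mem_support_iff] using hI₁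
      simp [this]
  refine hrisk.trans ?_
  rw [hgmin, add_assoc]
  refine add_le_add (classSurrogateRisk_le hL hU hLU _) ?_
  have hα : 0 ≤ (n : ℝ) ^ (-α) := by positivity
  have hβ : 0 ≤ (n : ℝ) ^ (-β) := by positivity
  have hone : 1 ≤ l ^ (-(1 / 2) : ℝ) :=
    Real.one_le_rpow_of_pos_of_le_one_of_nonpos hlam hlam1.le (by norm_num)
  have hrate0 : 0 ≤ rate := by positivity
  -- As λ < 1, the constant part 2 + R' is also absorbed into λ^(-1/2).
  have hRle : 2 * (2 + R + R') ≤ 2 * (2 + ρ + R') * l ^ (-(1 / 2) : ℝ) := by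
    rw [hR]
    nlinarith
  have hnoise : 4 * M * (C₀ * l⁻¹ * C) / √(c₀ * n)
      = 4 * M * C₀ * C / √c₀ * ((n : ℝ) ^ (-(1 / 2) : ℝ) * l⁻¹) := by
    rw [Real.sqrt_mul hc₀.le, Real.rpow_neg hn0.le, ← Real.sqrt_eq_rpow]
    field_simp
  calc ENNReal.ofReal rate + ENNReal.ofReal (2 * (2 + R + R')) *
          (ENNReal.ofReal (K₁ * (n : ℝ) ^ (-α)) + ENNReal.ofReal (K₂ * (n : ℝ) ^ (-β)))
      ≤ ENNReal.ofReal rate + ENNReal.ofReal (2 * (2 + ρ + R') * l ^ (-(1 / 2) : ℝ)) *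
          (ENNReal.ofReal (k₁ * (n : ℝ) ^ (-α)) + ENNReal.ofReal (k₂ * (n : ℝ) ^ (-β))) := by
        gcongr
        exacts [le_max_left _ _, le_max_left _ _]
    _ = ENNReal.ofReal (rate + 2 * (2 + ρ + R') * l ^ (-(1 / 2) : ℝ) *
          (k₁ * (n : ℝ) ^ (-α) + k₂ * (n : ℝ) ^ (-β))) := by
        rw [← ENNReal.ofReal_add (by positivity) (by positivity),
          ← ENNReal.ofReal_mul (by positivity), ← ENNReal.ofReal_add hrate0 (by positivity)]
    _ ≤ _ := by
        apply ENNReal.ofReal_le_ofReal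
        rw [hrate, hnoise]
        set p := (n : ℝ) ^ (-(1 / 2) : ℝ) * l⁻¹
        have hp : 0 ≤ p := by positivity
        set a := (n : ℝ) ^ (-α)
        set b := (n : ℝ) ^ (-β)
        set w := l ^ (-(1 / 2) : ℝ)
        set c₁ := N g ^ 2 / 2
        have hc₁ : 0 ≤ c₁ := by positivity
        set c₂ := 4 * M * C₀ * C / √c₀
        have hc₂ : 0 ≤ c₂ := by positivity
        set c₃ := 2 * (2 + ρ + R')
        have hc₃ : 0 ≤ c₃ := by positivity
        -- A single constant multiplies the whole rate; the surplus consists of nonnegative cross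
        -- terms.
        have hsplit3 : (c₁ + c₂ + c₃ * (k₁ + k₂)) * (l + p + w * (a + b))
            - (c₁ * l + c₂ * p + c₃ * w * (k₁ * a + k₂ * b))
            = c₁ * (p + w * (a + b)) + c₂ * (l + w * (a + b)) + c₃ * (k₁ + k₂) * (l + p)
              + c₃ * w * (k₁ * b + k₂ * a) := by ring
        have hnn : 0 ≤ c₁ * (p + w * (a + b)) + c₂ * (l + w * (a + b))
            + c₃ * (k₁ + k₂) * (l + p) + c₃ * w * (k₁ * b + k₂ * a) := by positivity
        have hcl : l / 2 * N g ^ 2 = c₁ * l := by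
          simp only [c₁]
          ring
        rw [hcl]
        linarith
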